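/- An equivalence structure $\mathcal A=(A,E)$ consists of a computable set $A\subseteq\mathbb N$ and an equivalence relation $E$ on $A$; it is identified with its atomic diagram, the set of (Gödel numbers of) atomic formulas and negated atomic formulas with parameters from $A$ that are true in $\mathcal A$, and it is computable if this set is computable. An embedding of $\mathcal A$ in $\mathcal B$ is an injective map $\nu:A\to B$ with $x\,E^{\mathcal A}y\iff \nu(x)\,E^{\mathcal B}\nu(y)$. If $\mathcal A$ and $\mathcal B$ each embed in the other, they are called bi-embeddable, and $\mathcal B$ is a bi-embeddable copy of $\mathcal A$. A computable equivalence structure $\mathcal A$ is $\Delta^0_2$ bi-embeddably categorical if for every computable bi-embeddable copy $\mathcal B$ of $\mathcal A$ there are $\mathbf 0'$-computable embeddings of $\mathcal A$ in $\mathcal B$ and of $\mathcal B$ in $\mathcal A$. An equivalence structure $\mathcal A$ is relatively $\Delta^0_2$ bi-embeddably categorical if for every (not necessarily computable) bi-embeddable copy $\mathcal B$ of $\mathcal A$ there are embeddings of $\mathcal A$ in $\mathcal B$ and of $\mathcal B$ in $\mathcal A$ whose graphs are $\Delta_2^{\mathcal A\oplus\mathcal B}$, i.e. $\Delta_2$ relative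 to the join of the atomic diagrams. **Corollary.** Let $\mathcal A$ be a computable equivalence structure. Then $\mathcal A$ is $\Delta^0_2$ bi-embeddably categorical if and only if it is relatively $\Delta^0_2$ bi-embeddably categorical. -/

import Mathlib

open Computability

/-- The characteristic function of a set of natural numbers, as a (total) oracle. -/
noncomputable def charFn (X : Set ℕ) : ℕ →. ℕ :=
  open Classical in fun n => Part.some (if n ∈ X then 1 else 0)

/-- The join `X ⊕ Y = {2n : n ∈ X} ∪ {2n + 1 : n ∈ Y}`. -/
def turingJoin (X Y : Set ℕ) : Set ℕ :=
  {k | (∃ n ∈ X, k = 2 * n) ∨ (∃ n ∈ Y, k = 2 * n + 1)}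

/-- The halting set `{e : φ_e(e) halts}`, a set of Turing degree `0'`. -/
def haltingSet : Set ℕ :=
  {e | ((Denumerable.ofNat Nat.Partrec.Code e).eval e).Dom}

/-- `P` is `Σ_n` relative to `X`: the `Σ_0` sets are the `X`-computable ones, and a `Σ_{n+1}` set is
the projection of a `Π_n` set, i.e. of a set whose complement is `Σ_n`. -/
def IsSigma (X : Set ℕ) : ℕ → Set ℕ → Prop
  | 0, P => charFn P ≤ᵀ charFn X
  | n + 1, P => ∃ Q : Set ℕ, IsSigma X n Qᶜ ∧ P = {a | ∃ b, Nat.pair a b ∈ Q}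

/-- `P` is `Π_n` relative to `X`. -/
def IsPi (X : Set ℕ) (n : ℕ) (P : Set ℕ) : Prop := IsSigma X n Pᶜ

/-- `P` is `Δ_n` relative to `X`. -/
def IsDelta (X : Set ℕ) (n : ℕ) (P : Set ℕ) : Prop := IsSigma X n P ∧ IsPi X n P

/-- An equivalence structure: a computable set of natural numbers as universe, with an (arbitrary)
equivalence relation on it. -/
structure EquivStructure where
  /-- the universe -/
  carrier : Set ℕ
  computable_carrier : ComputablePred (fun n => n ∈ carrier)
  /-- the equivalence relation -/
  setoid : Setoid carrier

namespace EquivStructure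

/-- The equivalence relation of `A`. -/
def E (A : EquivStructure) : A.carrier → A.carrier → Prop := A.setoid.r

/-- The atomic diagram of `A`: the set of the Gödel numbers of all the formulas `x = y`, `x ≠ y`,
`x E y`, `¬ x E y` with parameters in the universe that are true in `A`. The four kinds of
formula with parameters `x, y` have Gödel numbers `⟨0,⟨x,y⟩⟩, …, ⟨3,⟨x,y⟩⟩`. -/
def atomicDiagram (A : EquivStructure) : Set ℕ :=
  {k | ∃ x y : A.carrier,
    (k = Nat.pair 0 (Nat.pair x y) ∧ x = y) ∨
    (k = Nat.pair 1 (Nat.pair x y) ∧ x ≠ y) ∨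
    (k = Nat.pair 2 (Nat.pair x y) ∧ A.E x y) ∨
    (k = Nat.pair 3 (Nat.pair x y) ∧ ¬ A.E x y)}

/-- `A` is a computable structure if its atomic diagram is computable. -/
def IsComputable (A : EquivStructure) : Prop :=
  ComputablePred (fun n => n ∈ A.atomicDiagram)

/-- Embeddings of `A` in `B`: injective maps that preserve and reflect the relation. -/
abbrev Embedding (A B : EquivStructure) : Type := A.E ↪r B.E

/-- `A` and `B` are bi-embeddable. -/
def BiEmbeddable (A B : EquivStructure) : Prop :=
  Nonempty (Embedding A B) ∧ Nonempty (Embedding B A)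

/-- An embedding of `A` in `B`, as a partial function on `ℕ` whose domain is the universe of `A`. -/
def Embedding.toPFun {A B : EquivStructure} (f : Embedding A B) : ℕ →. ℕ :=
  fun n => ⟨n ∈ A.carrier, fun h => (f ⟨n, h⟩ : ℕ)⟩

/-- The set of (codes of) the pairs in the graph of an embedding. -/
def Embedding.graph {A B : EquivStructure} (f : Embedding A B) : Set ℕ :=
  {k | ∃ x : A.carrier, k = Nat.pair x (f x)}

/-- For the Turing degree `d` of the set `D`: `A` is `d`-computably bi-embeddably categorical. -/
def ComputablyBiembCategorical (D : Set ℕ) (A : EquivStructure) : Prop :=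
  ∀ B : EquivStructure, B.IsComputable → BiEmbeddable A B →
    (∃ f : Embedding A B, f.toPFun ≤ᵀ charFn D) ∧
    (∃ g : Embedding B A, g.toPFun ≤ᵀ charFn D)

/-- `A` is `Δ⁰₂` bi-embeddably categorical, i.e. `0'`-computably bi-embeddably categorical. -/
def DeltaTwoBiembCategorical (A : EquivStructure) : Prop :=
  ComputablyBiembCategorical haltingSet A

/-- `A` is relatively `Δ⁰_n` bi-embeddably categorical: every (not necessarily computable)
bi-embeddable copy `B` of `A` is bi-embeddable with `A` by embeddings that are `Δ_n` relative to
`A ⊕ B`. -/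
def RelativelyDeltaBiembCategorical (n : ℕ) (A : EquivStructure) : Prop :=
  ∀ B : EquivStructure, BiEmbeddable A B →
    (∃ f : Embedding A B, IsDelta (turingJoin A.atomicDiagram B.atomicDiagram) n f.graph) ∧
    (∃ g : Embedding B A, IsDelta (turingJoin A.atomicDiagram B.atomicDiagram) n g.graph)

end EquivStructure

-- For computable `A`, both properties are equivalent to `FinitelyManyInfinite`: only finitely many
-- classes of `A` are infinite.
--
-- Suppose this holds and `e` embeds `A` in `B`. Call a class exceptional if it is infinite, or if
-- it has at least `n` elements for some `n` such that only finitely many classes do. There are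
-- finitely many exceptional classes, and a finite table sends them where `e` does. For any other
-- class with least element `i`, let `M i` be the largest size of a non-exceptional class with least
-- element at most `i`. Infinitely many classes of `B` have at least `M i` elements, and the class
-- goes to one chosen by counting among these (`exists_rep_map`). As "at least `n` elements" is `Σ₁`
-- in the diagrams, this map of classes is `Σ₂`, and `exists_isEmb_of_rep_map` turns it into an
-- embedding. The finiteness condition passes from `A` to `B`, which gives the other direction.
--
-- If `B` is computable, so is the join of the diagrams, and a function with `Σ₂` graph can be
-- computed by a search with oracle `0'` (`Embedding.toPFun_turingReducible`). So the relative
-- property implies the other one.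
--
-- Finally suppose that `A` has infinitely many infinite classes. Then `A` is bi-embeddable with
-- every structure of this kind. Let `S` be a `Σ₂` set with infinite complement that meets every
-- infinite `Σ₂` set (Post's simple set, one level up). Take a computable structure with all classes
-- infinite and another whose class `x` is infinite exactly when `x ∉ S`. Composing `0'`-computable
-- embeddings through `A` gives a `Σ₂` map from the former to the latter. The classes that it hits
-- are infinite and form an infinite `Σ₂` set disjoint from `S`, a contradiction.

-- Closure properties of computable functions and predicates.

attribute [fun_prop] Computable Computable.id Computable.const Computable.fst Computable.snd

namespace Computable

variable {α β γ : Type*} [Primcodable α] [Primcodable β] [Primcodable γ]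

@[fun_prop] theorem fun_id : Computable (fun a : α => a) := Computable.id

@[fun_prop] theorem fun_comp {f : β → γ} {g : α → β} (hf : Computable f) (hg : Computable g) :
    Computable (fun x => f (g x)) := hf.comp hg

@[fun_prop] theorem fun_pair {f : α → β} {g : α → γ} (hf : Computable f) (hg : Computable g) :
    Computable (fun x => (f x, g x)) := hf.pair hg

@[fun_prop] theorem fun_fst {f : α → β × γ} (hf : Computable f) : Computable (fun x => (f x).1) :=
  Computable.fst.comp hf

@[fun_prop] theorem fun_snd {f : α → β × γ} (hf : Computable f) : Computable (fun x => (f x).2) :=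
  Computable.snd.comp hf

@[fun_prop] theorem fun_add {f g : α → ℕ} (hf : Computable f) (hg : Computable g) :
    Computable (fun x => f x + g x) := Primrec.nat_add.to_comp.comp hf hg

@[fun_prop] theorem fun_sub {f g : α → ℕ} (hf : Computable f) (hg : Computable g) :
    Computable (fun x => f x - g x) := Primrec.nat_sub.to_comp.comp hf hg

@[fun_prop] theorem fun_mul {f g : α → ℕ} (hf : Computable f) (hg : Computable g) :
    Computable (fun x => f x * g x) := Primrec.nat_mul.to_comp.comp hf hg

@[fun_prop] theorem fun_natPair {f g : α → ℕ} (hf : Computable f) (hg : Computable g) :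
    Computable (fun x => Nat.pair (f x) (g x)) := Primrec₂.natPair.to_comp.comp hf hg

@[fun_prop] theorem fun_natUnpair {f : α → ℕ} (hf : Computable f) :
    Computable (fun x => Nat.unpair (f x)) := Computable.unpair.comp hf

@[fun_prop] theorem fun_getI {f : α → List ℕ} {g : α → ℕ} (hf : Computable f)
    (hg : Computable g) : Computable (fun x => (f x).getI (g x)) :=
  Primrec.list_getI.to_comp.comp hf hg

@[fun_prop] theorem fun_ofNat {δ : Type*} [Denumerable δ] {f : α → ℕ} (hf : Computable f) :
    Computable (fun x => Denumerable.ofNat δ (f x)) := (Computable.ofNat δ).comp hf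

@[fun_prop] theorem fun_encode {f : α → β} (hf : Computable f) :
    Computable (fun x => Encodable.encode (f x)) := Computable.encode.comp hf

end Computable

namespace ComputablePred

variable {α : Type*} [Primcodable α]

theorem eq_nat {f g : α → ℕ} (hf : Computable f) (hg : Computable g) :
    ComputablePred fun x => f x = g x :=
  ⟨inferInstance, (PrimrecPred.decide Primrec.eq).to_comp.comp (hf.pair hg)⟩

theorem lt_nat {f g : α → ℕ} (hf : Computable f) (hg : Computable g) :
    ComputablePred fun x => f x < g x :=
  ⟨inferInstance, (PrimrecRel.decide Primrec.nat_lt).to_comp.comp hf hg⟩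

theorem le_nat {f g : α → ℕ} (hf : Computable f) (hg : Computable g) :
    ComputablePred fun x => f x ≤ g x :=
  ⟨inferInstance, (PrimrecRel.decide Primrec.nat_le).to_comp.comp hf hg⟩

theorem comp_computable {β : Type*} [Primcodable β] {p : β → Prop} (hp : ComputablePred p)
    {f : α → β} (hf : Computable f) : ComputablePred fun x => p (f x) := by
  obtain ⟨_, h⟩ := hp
  exact ⟨inferInstance, h.comp hf⟩

theorem mem_finite {s : Set ℕ} (hs : s.Finite) : ComputablePred fun n => n ∈ s := by
  induction s, hs using Set.Finite.induction_on with
  | empty => exact ⟨inferInstanceAs (DecidablePred fun _ => False), Computable.const false⟩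
  | @insert a s _ _ ih =>
    obtain ⟨_, h⟩ := ih
    obtain ⟨_, h'⟩ := eq_nat (Computable.id (α := ℕ)) (Computable.const a)
    refine (Computable.computablePred (p := fun n => n = a ∨ n ∈ s) ?_).of_eq (by simp)
    exact (Primrec.or.to_comp.comp h' h).of_eq fun n => by
      simp only [id, ← Bool.decide_or]

end ComputablePred

/-! ### Computability and decidability relative to a set. -/

/-- A total function on `ℕ` that is computable from the set `X`. -/
def TotalRecursiveIn (X : Set ℕ) (g : ℕ → ℕ) : Prop :=
  Nat.RecursiveIn {charFn X} fun n => Part.some (g n)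

namespace TotalRecursiveIn

variable {X : Set ℕ} {f g : ℕ → ℕ}

theorem of_computable (hf : Computable f) : TotalRecursiveIn X f :=
  Nat.Partrec.recursiveIn (Partrec.nat_iff.1 hf)

theorem comp (hf : TotalRecursiveIn X f) (hg : TotalRecursiveIn X g) :
    TotalRecursiveIn X fun n => f (g n) :=
  (Nat.RecursiveIn.comp hf hg).of_eq fun n => by simp

theorem natPair (hf : TotalRecursiveIn X f) (hg : TotalRecursiveIn X g) :
    TotalRecursiveIn X fun n => Nat.pair (f n) (g n) :=
  (Nat.RecursiveIn.pair hf hg).of_eq fun n => by simp [Seq.seq]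

theorem comp₂ {h : ℕ → ℕ → ℕ} (hh : Computable₂ h) (hf : TotalRecursiveIn X f)
    (hg : TotalRecursiveIn X g) : TotalRecursiveIn X fun n => h (f n) (g n) := by
  have hh' : Computable fun n : ℕ => h n.unpair.1 n.unpair.2 :=
    hh.comp (by fun_prop) (by fun_prop)
  simpa using (of_computable hh').comp (hf.natPair hg)

theorem prec {h : ℕ → ℕ} (hf : TotalRecursiveIn X f) (hh : TotalRecursiveIn X h) :
    TotalRecursiveIn X fun p =>
      Nat.rec (motive := fun _ => ℕ) (f p.unpair.1)
        (fun y i => h (Nat.pair p.unpair.1 (Nat.pair y i))) p.unpair.2 := by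
  refine (Nat.RecursiveIn.prec hf hh).of_eq fun p => ?_
  simp only
  induction p.unpair.2 with
  | zero => rfl
  | succ n ih => simp only [ih]; simp

theorem bound_sum (hf : TotalRecursiveIn X f) :
    TotalRecursiveIn X fun p => ∑ i ∈ Finset.range p.unpair.2, f (Nat.pair p.unpair.1 i) := by
  have h : TotalRecursiveIn X fun q =>
      f (Nat.pair q.unpair.1 q.unpair.2.unpair.1) + q.unpair.2.unpair.2 :=
    comp₂ (h := fun a b => a + b) Primrec.nat_add.to_comp
      (hf.comp (of_computable (by fun_prop))) (of_computable (by fun_prop))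
  have := prec (of_computable (Computable.const 0)) h
  convert this using 2 with p
  induction p.unpair.2 with
  | zero => rfl
  | succ n ih => rw [Finset.sum_range_succ, ih]; simp [add_comm]

end TotalRecursiveIn

/-- `P` is decidable relative to the set `X`. -/
def DecidableIn (X : Set ℕ) {α : Type} [Primcodable α] (P : α → Prop) : Prop :=
  ∃ g : ℕ → ℕ, TotalRecursiveIn X g ∧ ∀ a, P a ↔ g (Encodable.encode a) = 0

namespace DecidableIn

variable {X : Set ℕ} {α β : Type} [Primcodable α] [Primcodable β] {P Q : α → Prop}

theorem of_iff (hP : DecidableIn X P) (h : ∀ a, Q a ↔ P a) : DecidableIn X Q := by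
  rwa [show Q = P from funext fun a => propext (h a)]

theorem not (hP : DecidableIn X P) : DecidableIn X fun a => ¬ P a := by
  obtain ⟨g, hg, h⟩ := hP
  refine ⟨fun n => 1 - g n, (TotalRecursiveIn.of_computable (f := fun n => 1 - n)
    (by fun_prop)).comp hg, fun a => ?_⟩
  simp only [h]; omega

theorem and (hP : DecidableIn X P) (hQ : DecidableIn X Q) : DecidableIn X fun a => P a ∧ Q a := by
  obtain ⟨g, hg, h⟩ := hP
  obtain ⟨g', hg', h'⟩ := hQ
  refine ⟨fun n => g n + g' n, TotalRecursiveIn.comp₂ Primrec.nat_add.to_comp hg hg', fun a => ?_⟩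
  simp only [h, h']; omega

theorem or (hP : DecidableIn X P) (hQ : DecidableIn X Q) : DecidableIn X fun a => P a ∨ Q a :=
  (hP.not.and hQ.not).not.of_iff fun a => by tauto

theorem comp (hP : DecidableIn X P) {f : β → α} (hf : Computable f) :
    DecidableIn X fun b => P (f b) := by
  obtain ⟨g, hg, h⟩ := hP
  have hF : Computable fun n =>
      ((Encodable.decode (α := β) n).map fun b => Encodable.encode (f b)).getD 0 :=
    Computable.option_getD (Computable.option_map Computable.decode
      (Computable.comp (f := fun b => Encodable.encode (f b)) (by fun_prop) Computable.snd).to₂)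
      (Computable.const 0)
  refine ⟨_, hg.comp (TotalRecursiveIn.of_computable hF), fun b => ?_⟩
  simp [h]

/-- Since the value 0 codes truth, a bounded universal statement says that the sum in `bound_sum`
vanishes. -/
theorem ball {P : α × ℕ → Prop} (hP : DecidableIn X P) :
    DecidableIn X fun p : α × ℕ => ∀ i < p.2, P (p.1, i) := by
  obtain ⟨g, hg, h⟩ := hP
  refine ⟨_, hg.bound_sum, fun ⟨a, n⟩ => ?_⟩
  simp [h]

theorem bex {P : α × ℕ → Prop} (hP : DecidableIn X P) :
    DecidableIn X fun p : α × ℕ => ∃ i < p.2, P (p.1, i) :=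
  hP.not.ball.not.of_iff fun p => by simp

theorem of_computablePred (hP : ComputablePred P) : DecidableIn X P := by
  obtain ⟨_, h⟩ := hP
  have hF : Computable fun n =>
      ((Encodable.decode (α := α) n).map fun b => bif decide (P b) then 0 else 1).getD 0 :=
    Computable.option_getD (Computable.option_map Computable.decode
      (Computable.cond (h.comp Computable.snd) (Computable.const 0) (Computable.const 1)).to₂)
      (Computable.const 0)
  refine ⟨_, TotalRecursiveIn.of_computable hF, fun b => ?_⟩
  by_cases hb : P b <;> simp [hb]

theorem iff_turingReducible {P : Set ℕ} :
    DecidableIn X (fun n => n ∈ P) ↔ charFn P ≤ᵀ charFn X := by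
  rw [TuringReducible, RecursiveIn.iff_nat]
  constructor
  · rintro ⟨g, hg, h⟩
    refine ((TotalRecursiveIn.of_computable (f := fun n => 1 - n) (by fun_prop)).comp hg).of_eq
      fun n => ?_
    have := h n
    simp only [Encodable.encode_nat] at this
    by_cases hn : g n = 0
    · simp [charFn, this, hn]
    · simp [charFn, this, hn, Nat.one_le_iff_ne_zero]
  · intro h
    classical
    refine ⟨fun n => 1 - if n ∈ P then 1 else 0,
      TotalRecursiveIn.comp (X := X) (TotalRecursiveIn.of_computable (f := fun n => 1 - n)
        (by fun_prop)) (g := fun n => if n ∈ P then 1 else 0) (h.of_eq fun n => ?_), fun n => ?_⟩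
    · simp only [charFn]
    · by_cases hn : n ∈ P <;> simp [hn]

theorem oracle (X : Set ℕ) : DecidableIn X fun n => n ∈ X :=
  iff_turingReducible.2 (TuringReducible.refl _)

end DecidableIn

/-! ### Closure properties of the relativized arithmetical hierarchy. -/

/-- `P` is `Σ_n` relative to `X`, for predicates on any type with a primitive recursive coding. -/
def Sig (X : Set ℕ) : ℕ → ∀ {α : Type} [Primcodable α], (α → Prop) → Prop
  | 0, _, _, P => DecidableIn X P
  | n + 1, α, _, P => ∃ Q : α × ℕ → Prop, Sig X n (fun p => ¬ Q p) ∧ ∀ a, P a ↔ ∃ b, Q (a, b)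

namespace Sig

variable {X : Set ℕ} {n : ℕ} {α β : Type} [Primcodable α] [Primcodable β] {P Q : α → Prop}

theorem of_iff (hP : Sig X n P) (h : ∀ a, Q a ↔ P a) : Sig X n Q := by
  rwa [show Q = P from funext fun a => propext (h a)]

theorem comp (hP : Sig X n P) {f : β → α} (hf : Computable f) : Sig X n fun b => P (f b) := by
  induction n generalizing α β with
  | zero => exact DecidableIn.comp hP hf
  | succ n ih =>
    obtain ⟨R, hR, h⟩ := hP
    exact ⟨fun p => R (f p.1, p.2), ih hR (f := fun p : β × ℕ => (f p.1, p.2)) (by fun_prop),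
      fun b => h _⟩

theorem of_computablePred (hP : ComputablePred P) : Sig X n P := by
  induction n generalizing α with
  | zero => exact DecidableIn.of_computablePred hP
  | succ n ih =>
    exact ⟨fun p => P p.1, ih (hP.comp_computable Computable.fst).not, fun a => by simp⟩

/-- The matrix occurs negated in `Sig`, so the induction step for each connective needs the
hypothesis for the other. -/
theorem and_or (X : Set ℕ) (n : ℕ) {α : Type} [Primcodable α] {P Q : α → Prop}
    (hP : Sig X n P) (hQ : Sig X n Q) :
    Sig X n (fun a => P a ∧ Q a) ∧ Sig X n (fun a => P a ∨ Q a) := by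
  induction n generalizing α with
  | zero => exact ⟨DecidableIn.and hP hQ, DecidableIn.or hP hQ⟩
  | succ n ih =>
    obtain ⟨R, hR, h⟩ := hP
    obtain ⟨R', hR', h'⟩ := hQ
    constructor
    · refine ⟨fun p => R (p.1, p.2.unpair.1) ∧ R' (p.1, p.2.unpair.2),
        (ih (comp hR (f := fun p : α × ℕ => (p.1, p.2.unpair.1)) (by fun_prop))
          (comp hR' (f := fun p : α × ℕ => (p.1, p.2.unpair.2)) (by fun_prop))).2.of_iff
        fun a => by tauto, fun a => ?_⟩
      simp only [h, h']
      constructor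
      · rintro ⟨⟨b, hb⟩, c, hc⟩
        exact ⟨Nat.pair b c, by simp [hb, hc]⟩
      · rintro ⟨b, hb, hc⟩
        exact ⟨⟨_, hb⟩, _, hc⟩
    · refine ⟨fun p => R p ∨ R' p, (ih hR hR').1.of_iff fun a => by tauto, fun a => ?_⟩
      simp only [h, h', exists_or]

theorem and (hP : Sig X n P) (hQ : Sig X n Q) : Sig X n fun a => P a ∧ Q a :=
  (and_or X n hP hQ).1

theorem or (hP : Sig X n P) (hQ : Sig X n Q) : Sig X n fun a => P a ∨ Q a :=
  (and_or X n hP hQ).2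

/-- As in `and_or`, negation swaps the two quantifiers. In the universal case the witnesses for all
`i` below the bound are collected in one coded list. -/
theorem ball_bex (X : Set ℕ) (n : ℕ) {α : Type} [Primcodable α] {P : α × ℕ → Prop}
    (hP : Sig X n P) :
    Sig X n (fun p : α × ℕ => ∀ i < p.2, P (p.1, i)) ∧
      Sig X n (fun p : α × ℕ => ∃ i < p.2, P (p.1, i)) := by
  induction n generalizing α with
  | zero => exact ⟨DecidableIn.ball hP, DecidableIn.bex hP⟩
  | succ n ih =>
    obtain ⟨R, hR, h⟩ := hP
    constructor
    · have h1 := (ih (comp hR (f := fun q : (α × ℕ) × ℕ =>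
        ((q.1.1, q.2), (Denumerable.ofNat (List ℕ) q.1.2).getI q.2)) (by fun_prop))).2
      refine ⟨fun p => ∀ i < p.1.2,
        R ((p.1.1, i), (Denumerable.ofNat (List ℕ) p.2).getI i),
        (comp h1 (f := fun p : (α × ℕ) × ℕ => ((p.1.1, p.2), p.1.2)) (by fun_prop)).of_iff
          fun p => by simp, fun p => ?_⟩
      simp only [h]
      constructor
      · intro H
        choose! w hw using H
        refine ⟨Encodable.encode ((List.range p.2).map w), fun i hi => ?_⟩
        rw [Denumerable.ofNat_encode, List.getI_eq_getElem _ (by simpa using hi)]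
        simpa using hw i hi
      · rintro ⟨b, hb⟩ i hi
        exact ⟨_, hb i hi⟩
    · refine ⟨fun p => p.2.unpair.1 < p.1.2 ∧ R ((p.1.1, p.2.unpair.1), p.2.unpair.2),
        (or (of_computablePred (ComputablePred.le_nat (f := fun p : (α × ℕ) × ℕ => p.1.2)
          (g := fun p => p.2.unpair.1) (by fun_prop) (by fun_prop)))
          (comp hR (f := fun p : (α × ℕ) × ℕ => ((p.1.1, p.2.unpair.1), p.2.unpair.2))
            (by fun_prop))).of_iff fun p => by rw [← not_lt]; tauto, fun p => ?_⟩
      simp only [h]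
      constructor
      · rintro ⟨i, hi, b, hb⟩
        exact ⟨Nat.pair i b, by simp [hi, hb]⟩
      · rintro ⟨b, hi, hb⟩
        exact ⟨_, hi, _, hb⟩

theorem ball {P : α → ℕ → Prop} {f : α → ℕ} (hf : Computable f)
    (hP : Sig X n fun p : α × ℕ => P p.1 p.2) : Sig X n fun a => ∀ i < f a, P a i :=
  (ball_bex X n hP).1.comp (f := fun a => (a, f a)) (by fun_prop)

theorem bex {P : α → ℕ → Prop} {f : α → ℕ} (hf : Computable f)
    (hP : Sig X n fun p : α × ℕ => P p.1 p.2) : Sig X n fun a => ∃ i < f a, P a i :=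
  (ball_bex X n hP).2.comp (f := fun a => (a, f a)) (by fun_prop)

theorem ex {P : α → ℕ → Prop} (hP : Sig X (n + 1) fun p : α × ℕ => P p.1 p.2) :
    Sig X (n + 1) fun a => ∃ b, P a b := by
  obtain ⟨R, hR, h⟩ := hP
  refine ⟨fun p => R ((p.1, p.2.unpair.1), p.2.unpair.2),
    hR.comp (f := fun p : α × ℕ => ((p.1, p.2.unpair.1), p.2.unpair.2)) (by fun_prop), fun a => ?_⟩
  have h' := fun b => h (a, b)
  simp only at h'
  simp only [h']
  constructor
  · rintro ⟨b, c, hc⟩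
    exact ⟨Nat.pair b c, by simpa using hc⟩
  · rintro ⟨b, hb⟩
    exact ⟨_, _, hb⟩

theorem ex_denumerable {δ : Type} [Denumerable δ] {P : α → δ → Prop}
    (hP : Sig X (n + 1) fun p : α × δ => P p.1 p.2) : Sig X (n + 1) fun a => ∃ b, P a b :=
  (ex (P := fun a b => P a (Denumerable.ofNat δ b))
    (hP.comp (f := fun p : α × ℕ => (p.1, Denumerable.ofNat δ p.2)) (by fun_prop))).of_iff fun a =>
    ⟨fun ⟨b, hb⟩ => ⟨Encodable.encode b, by simpa using hb⟩, fun ⟨b, hb⟩ => ⟨_, hb⟩⟩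

theorem of_not (hP : Sig X n fun a => ¬ P a) : Sig X (n + 1) P :=
  ⟨fun p => P p.1, hP.comp Computable.fst, fun a => by simp⟩

theorem not_zero (hP : Sig X 0 P) : Sig X 0 fun a => ¬ P a := DecidableIn.not hP

theorem succ (hP : Sig X n P) : Sig X (n + 1) P := by
  induction n generalizing α with
  | zero => exact of_not (not_zero hP)
  | succ n ih =>
    obtain ⟨R, hR, h⟩ := hP
    exact ⟨R, ih hR, h⟩

theorem not_of_zero (hP : Sig X 0 P) : Sig X n P := by
  induction n with
  | zero => exact hP
  | succ n ih => exact ih.succ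

theorem eq_nat {f g : α → ℕ} (hf : Computable f) (hg : Computable g) :
    Sig X n fun x => f x = g x := of_computablePred (.eq_nat hf hg)

theorem lt_nat {f g : α → ℕ} (hf : Computable f) (hg : Computable g) :
    Sig X n fun x => f x < g x := of_computablePred (.lt_nat hf hg)

theorem le_nat {f g : α → ℕ} (hf : Computable f) (hg : Computable g) :
    Sig X n fun x => f x ≤ g x := of_computablePred (.le_nat hf hg)

theorem ne_nat {f g : α → ℕ} (hf : Computable f) (hg : Computable g) :
    Sig X n fun x => f x ≠ g x := of_computablePred (ComputablePred.eq_nat hf hg).not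

end Sig

theorem isSigma_iff_sig {X : Set ℕ} {n : ℕ} {P : Set ℕ} :
    IsSigma X n P ↔ Sig X n fun a => a ∈ P := by
  induction n generalizing P with
  | zero => exact DecidableIn.iff_turingReducible.symm
  | succ n ih =>
    constructor
    · rintro ⟨Q, hQ, rfl⟩
      exact ⟨fun p => Nat.pair p.1 p.2 ∈ Q,
        (ih.1 hQ).comp (f := fun p : ℕ × ℕ => Nat.pair p.1 p.2) (by fun_prop), fun a => Iff.rfl⟩
    · rintro ⟨Q, hQ, h⟩
      refine ⟨{k | Q k.unpair}, ih.2 (hQ.comp (f := fun k : ℕ => k.unpair) (by fun_prop)), ?_⟩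
      ext a
      simp [h]

/-- The list of partial counts is the witness. Both `P` and its negation must be `Σ`, since each
step certifies either an increase or its absence. -/
theorem Sig.count_eq {X : Set ℕ} {n : ℕ} {α : Type} [Primcodable α] {P : α → ℕ → Prop}
    {_ : ∀ a, DecidablePred (P a)}
    (hP : Sig X (n + 1) fun p : α × ℕ => P p.1 p.2)
    (hN : Sig X (n + 1) fun p : α × ℕ => ¬ P p.1 p.2)
    {f g : α → ℕ} (hf : Computable f) (hg : Computable g) :
    Sig X (n + 1) fun a => Nat.count (P a) (f a) = g a := by
  have key : Sig X (n + 1) fun a => ∃ l : List ℕ, (l.getI 0 = 0 ∧ l.getI (f a) = g a) ∧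
      ∀ i < f a, (P a i ∧ l.getI (i + 1) = l.getI i + 1) ∨ (¬ P a i ∧ l.getI (i + 1) = l.getI i) := by
    refine Sig.ex_denumerable (.and (.and (.eq_nat (by fun_prop) (by fun_prop))
      (.eq_nat (by fun_prop) (by fun_prop))) (Sig.ball (by fun_prop) (.or (.and
      (hP.comp (f := fun q : (α × List ℕ) × ℕ => (q.1.1, q.2)) (by fun_prop))
      (.eq_nat (by fun_prop) (by fun_prop))) (.and
      (hN.comp (f := fun q : (α × List ℕ) × ℕ => (q.1.1, q.2)) (by fun_prop))
      (.eq_nat (by fun_prop) (by fun_prop))))))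
  refine key.of_iff fun a => ⟨fun h => ?_, ?_⟩
  · have hl : ∀ i ≤ f a, ((List.range (f a + 1)).map (Nat.count (P a))).getI i =
        Nat.count (P a) i := fun i hi => by
      rw [List.getI_eq_getElem _ (by simpa using Nat.lt_succ_of_le hi)]; simp
    refine ⟨(List.range (f a + 1)).map (Nat.count (P a)),
      ⟨by rw [hl 0 (by omega), Nat.count_zero], by rw [hl _ le_rfl, h]⟩, fun i hi => ?_⟩
    rw [hl i hi.le, hl (i + 1) hi, Nat.count_succ]
    by_cases h : P a i <;> simp [h]
  · rintro ⟨l, ⟨h0, hl⟩, h⟩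
    rw [← hl]
    have : ∀ i ≤ f a, Nat.count (P a) i = l.getI i := by
      intro i
      induction i with
      | zero => simp [h0]
      | succ i ih =>
        intro hi
        rw [Nat.count_succ, ih (by omega)]
        rcases h i hi with ⟨hp, e⟩ | ⟨hp, e⟩ <;> simp [hp, e]
    exact this _ le_rfl

/-! ### Partial equivalence relations on `ℕ` -/

namespace PER

open Classical in
/-- The class of `x` has at least `n` elements. -/
def AtLeast (R : ℕ → ℕ → Prop) (x n : ℕ) : Prop := ∃ N, n ≤ Nat.count (R x) N

/-- `x` is the least element of its class. -/
def Rep (R : ℕ → ℕ → Prop) (x : ℕ) : Prop := R x x ∧ ∀ y < x, ¬ R x y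

/-- `f` is an embedding of the partial equivalence relation `R` in `S`. -/
structure IsEmb (R S : ℕ → ℕ → Prop) (f : ℕ → ℕ) : Prop where
  rel_iff : ∀ x y, R x x → R y y → (S (f x) (f y) ↔ R x y)
  injOn : Set.InjOn f {x | R x x}

variable {R S : ℕ → ℕ → Prop} {X : Set ℕ}

theorem AtLeast.mono {x m n : ℕ} (h : AtLeast R x n) (hmn : m ≤ n) : AtLeast R x m :=
  h.imp fun _ => hmn.trans

theorem atLeast_zero (R : ℕ → ℕ → Prop) (x : ℕ) : AtLeast R x 0 := ⟨0, Nat.zero_le _⟩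

theorem sig_atLeast (hR : Sig X 0 fun p : ℕ × ℕ => R p.1 p.2) :
    Sig X 1 fun p : ℕ × ℕ => AtLeast R p.1 p.2 := by
  classical
  have h : Sig X 1 fun p : ℕ × ℕ => ∃ N c, Nat.count (R p.1) N = c ∧ p.2 ≤ c := by
    refine .ex (.ex (.and (Sig.count_eq (P := fun (p : ((ℕ × ℕ) × ℕ) × ℕ) i => R p.1.1.1 i)
      ?_ ?_ (by fun_prop) (by fun_prop)) (.le_nat (by fun_prop) (by fun_prop))))
    · exact hR.not_of_zero.comp (f := fun p : (((ℕ × ℕ) × ℕ) × ℕ) × ℕ => (p.1.1.1.1, p.2))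
        (by fun_prop)
    · exact hR.not_zero.not_of_zero.comp
        (f := fun p : (((ℕ × ℕ) × ℕ) × ℕ) × ℕ => (p.1.1.1.1, p.2)) (by fun_prop)
  refine h.of_iff fun p => exists_congr fun N => ⟨fun h => ⟨_, ?_, h⟩, ?_⟩
  · congr
  · rintro ⟨c, rfl, h⟩
    convert h

theorem sig_rep (hR : Sig X 0 fun p : ℕ × ℕ => R p.1 p.2) : Sig X 0 fun x => Rep R x :=
  .and (hR.comp (f := fun x : ℕ => (x, x)) (by fun_prop)) (.ball (by fun_prop) hR.not_zero)

theorem exists_rep [Std.Symm R] [IsTrans ℕ R] {x : ℕ} (hx : R x x) :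
    ∃ r, Rep R r ∧ R r x := by
  classical
  have h : ∃ r, R r x := ⟨x, hx⟩
  refine ⟨Nat.find h, ⟨_root_.trans (Nat.find_spec h) (symm (Nat.find_spec h)), fun y hy hr => ?_⟩,
    Nat.find_spec h⟩
  exact Nat.find_min h hy (_root_.trans (symm hr) (Nat.find_spec h))

theorem Rep.eq [Std.Symm R] {r s : ℕ} (hr : Rep R r) (hs : Rep R s) (h : R r s) : r = s := by
  rcases lt_trichotomy r s with hlt | heq | hlt
  · exact absurd (symm h) (hs.2 _ hlt)
  · exact heq
  · exact absurd h (hr.2 _ hlt)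

theorem AtLeast.congr [Std.Symm R] [IsTrans ℕ R] {x y n : ℕ} (h : AtLeast R x n)
    (hxy : R x y) : AtLeast R y n := by
  classical
  obtain ⟨N, hN⟩ := h
  refine ⟨N, hN.trans (Nat.count_mono_left fun k _ hk => ?_)⟩
  exact _root_.trans (symm hxy) hk

theorem IsEmb.atLeast [Std.Symm R] [IsTrans ℕ R] {f : ℕ → ℕ} (hf : IsEmb R S f) {x n : ℕ}
    (hx : R x x) (h : AtLeast R x n) : AtLeast S (f x) n := by
  classical
  obtain ⟨N, hN⟩ := h
  set D := (Finset.range N).filter (R x) with hD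
  refine ⟨(D.image f).sup id + 1, hN.trans ?_⟩
  rw [Nat.count_eq_card_filter_range, Nat.count_eq_card_filter_range]
  have hdom : ∀ y ∈ D, R y y := fun y hy => by
    have := (Finset.mem_filter.1 hy).2
    exact _root_.trans (symm this) this
  have hinj : Set.InjOn f D := fun a ha b hb => hf.injOn (hdom a ha) (hdom b hb)
  calc _ = (D.image f).card := by rw [Finset.card_image_of_injOn hinj]
    _ ≤ _ := Finset.card_le_card fun z hz => by
      have hle : z ≤ (D.image f).sup id := Finset.le_sup (f := id) hz
      obtain ⟨y, hy, rfl⟩ := Finset.mem_image.1 hz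
      simp only [Finset.mem_filter, Finset.mem_range]
      exact ⟨by omega, (hf.rel_iff x y hx (hdom y hy)).2 (Finset.mem_filter.1 hy).2⟩

/-- A `Σ₂` map of classes that does not decrease their sizes gives a `Σ₂` embedding. -/
theorem exists_isEmb_of_rep_map [Std.Symm R] [IsTrans ℕ R] [Std.Symm S] [IsTrans ℕ S]
    (hR : Sig X 0 fun p : ℕ × ℕ => R p.1 p.2) (hS : Sig X 0 fun p : ℕ × ℕ => S p.1 p.2)
    {T : ℕ → ℕ} (hT : ∀ r, Rep R r → Rep S (T r))
    (hsize : ∀ r n, Rep R r → AtLeast R r n → AtLeast S (T r) n)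
    (hinj : Set.InjOn T {r | Rep R r})
    (hgraph : Sig X 2 fun p : ℕ × ℕ => Rep R p.1 ∧ T p.1 = p.2) :
    ∃ f, IsEmb R S f ∧ Sig X 2 fun p : ℕ × ℕ => R p.1 p.1 ∧ f p.1 = p.2 := by
  classical
  choose! rep hrep hrel using fun x (hx : R x x) => exists_rep hx
  have hcong : ∀ x y, R x x → R y y → R x y → rep x = rep y := fun x y hx hy h =>
    (hrep x hx).eq (hrep y hy) (_root_.trans (_root_.trans (hrel x hx) h) (symm (hrel y hy)))
  have hcount : ∀ x, R x x → ∃ N, Nat.count (R (rep x)) x < Nat.count (S (T (rep x))) N := by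
    intro x hx
    refine hsize (rep x) (Nat.count (R (rep x)) x + 1) (hrep x hx) ⟨x + 1, ?_⟩
    rw [Nat.count_succ, if_pos (hrel x hx)]
  -- Each element goes to the element with the same position in the image class. By `hcount` that
  -- position exists, so `Nat.nth` never takes its default value.
  let f := fun x => Nat.nth (S (T (rep x))) (Nat.count (R (rep x)) x)
  have hcard : ∀ x, R x x → ∀ h : (Set.ofPred (S (T (rep x)))).Finite,
      Nat.count (R (rep x)) x < h.toFinset.card := fun x hx h => by
    obtain ⟨N, hN⟩ := hcount x hx
    exact hN.trans_le (Nat.count_le_card h N)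
  have hmem : ∀ x, R x x → S (T (rep x)) (f x) := fun x hx => Nat.nth_mem _ (hcard x hx)
  have hfc : ∀ x, R x x → Nat.count (S (T (rep x))) (f x) = Nat.count (R (rep x)) x :=
    fun x hx => Nat.count_nth (hcard x hx)
  have hiff : ∀ x y, R x x → R y y → (S (f x) (f y) ↔ R x y) := by
    intro x y hx hy
    constructor
    · intro h
      have h1 : S (T (rep x)) (T (rep y)) :=
        _root_.trans (_root_.trans (hmem x hx) h) (symm (hmem y hy))
      have h2 := hinj (hrep x hx) (hrep y hy) ((hT _ (hrep x hx)).eq (hT _ (hrep y hy)) h1)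
      exact _root_.trans (symm (hrel x hx)) (h2 ▸ hrel y hy)
    · intro h
      have h1 := hmem y hy
      rw [← hcong x y hx hy h] at h1
      exact _root_.trans (symm (hmem x hx)) h1
  refine ⟨f, ⟨hiff, fun x hx y hy hxy => ?_⟩, ?_⟩
  · have hf : S (f x) (f x) := _root_.trans (symm (hmem x hx)) (hmem x hx)
    have h : R x y := (hiff x y hx hy).1 (hxy ▸ hf)
    have hr := hcong x y hx hy h
    have h1 := hfc x hx
    rw [hxy, hr, hfc y hy] at h1
    have h2 := hrel x hx
    rw [hr] at h2
    exact (Nat.count_injective h2 (hrel y hy) h1.symm)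
  -- The witnesses are the least element `r` of the class, its image `d` and the position `k`; the
  -- position determines the value inside the class of `d`.
  · have key : Sig X 2 fun p : ℕ × ℕ => R p.1 p.1 ∧ ∃ r d k, ((Rep R r ∧ T r = d) ∧ R r p.1) ∧
        S d p.2 ∧ Nat.count (R r) p.1 = k ∧ Nat.count (S d) p.2 = k := by
      have hR' : ∀ {α : Type} [Primcodable α] {u v : α → ℕ}, Computable u → Computable v →
        Sig X 2 fun a => R (u a) (v a) := fun {α} _ {u v} hu hv =>
          hR.not_of_zero.comp (f := fun a => (u a, v a)) (by fun_prop)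
      have hS' : ∀ {α : Type} [Primcodable α] {u v : α → ℕ}, Computable u → Computable v →
        Sig X 2 fun a => S (u a) (v a) := fun {α} _ {u v} hu hv =>
          hS.not_of_zero.comp (f := fun a => (u a, v a)) (by fun_prop)
      have hRn : ∀ {α : Type} [Primcodable α] {u v : α → ℕ}, Computable u → Computable v →
        Sig X 2 fun a => ¬ R (u a) (v a) := fun {α} _ {u v} hu hv =>
          hR.not_zero.not_of_zero.comp (f := fun a => (u a, v a)) (by fun_prop)
      have hSn : ∀ {α : Type} [Primcodable α] {u v : α → ℕ}, Computable u → Computable v →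
        Sig X 2 fun a => ¬ S (u a) (v a) := fun {α} _ {u v} hu hv =>
          hS.not_zero.not_of_zero.comp (f := fun a => (u a, v a)) (by fun_prop)
      refine .and (hR' (by fun_prop) (by fun_prop)) (.ex (.ex (.ex (.and (.and
        (hgraph.comp (f := fun q : (((ℕ × ℕ) × ℕ) × ℕ) × ℕ => (q.1.1.2, q.1.2)) (by fun_prop))
        (hR' (by fun_prop) (by fun_prop))) (.and (hS' (by fun_prop) (by fun_prop)) (.and
        (Sig.count_eq (P := fun (q : (((ℕ × ℕ) × ℕ) × ℕ) × ℕ) i => R q.1.1.2 i) ?_ ?_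
          (by fun_prop) (by fun_prop))
        (Sig.count_eq (P := fun (q : (((ℕ × ℕ) × ℕ) × ℕ) × ℕ) i => S q.1.2 i) ?_ ?_
          (by fun_prop) (by fun_prop))))))))
      · exact hR' (by fun_prop) (by fun_prop)
      · exact hRn (by fun_prop) (by fun_prop)
      · exact hS' (by fun_prop) (by fun_prop)
      · exact hSn (by fun_prop) (by fun_prop)
    refine key.of_iff fun ⟨x, y⟩ => and_congr_right fun hx => ⟨?_, ?_⟩
    · rintro (rfl : f x = y)
      exact ⟨rep x, T (rep x), _, ⟨⟨hrep x hx, rfl⟩, hrel x hx⟩, hmem x hx, rfl, hfc x hx⟩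
    · rintro ⟨r, d, k, ⟨⟨hr, rfl⟩, hrx⟩, hy, rfl, hc⟩
      have hrr : rep x = r := (hrep x hx).eq hr (_root_.trans (hrel x hx) (symm hrx))
      subst hrr
      simp only [f]
      simp only at hc hy
      rw [← hc, Nat.nth_count hy]

/-- The embedding `e` is arbitrary, with no bound on its complexity. It only serves to show that
large enough classes of `S` exist, and to supply finitely many values. -/
theorem exists_rep_map [Std.Symm R] [IsTrans ℕ R] [Std.Symm S] [IsTrans ℕ S]
    (hR : Sig X 0 fun p : ℕ × ℕ => R p.1 p.2) (hS : Sig X 0 fun p : ℕ × ℕ => S p.1 p.2)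
    {e : ℕ → ℕ} (he : IsEmb R S e) (hfin : {x | Rep R x ∧ ∀ n, AtLeast R x n}.Finite) :
    ∃ T : ℕ → ℕ, (∀ r, Rep R r → Rep S (T r)) ∧
      (∀ r n, Rep R r → AtLeast R r n → AtLeast S (T r) n) ∧ Set.InjOn T {r | Rep R r} ∧
      Sig X 2 fun p : ℕ × ℕ => Rep R p.1 ∧ T p.1 = p.2 := by
  classical
  have hex : ∀ x, R x x → ∃ r, Rep S r ∧ S r (e x) := fun x hx =>
    exists_rep ((he.rel_iff x x hx hx).2 hx)
  choose! t ht hte using hex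
  have htinj : Set.InjOn t {r | Rep R r} := fun x hx y hy h => by
    have h1 := hte x hx.1
    rw [h] at h1
    exact hx.eq hy ((he.rel_iff x y hx.1 hy.1).1 (_root_.trans (symm h1) (hte y hy.1)))
  have htsize : ∀ r n, Rep R r → AtLeast R r n → AtLeast S (t r) n := fun r n hr h =>
    (he.atLeast hr.1 h).congr (symm (hte r hr.1))
  -- `F` holds the exceptional classes. It is finite: if some `n` is not good, all its members have
  -- at least as many elements as the least such `n`; otherwise its members are the infinite
  -- classes.
  let Good := fun n => {x | Rep R x ∧ AtLeast R x n}.Infinite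
  let F := {x | Rep R x ∧ ((∀ n, AtLeast R x n) ∨ ∃ n, AtLeast R x n ∧ ¬ Good n)}
  have hF : F.Finite := by
    by_cases hG : ∀ n, Good n
    · exact hfin.subset fun x hx => ⟨hx.1, hx.2.resolve_right fun ⟨n, _, h⟩ => h (hG n)⟩
    · push Not at hG
      have hspec := Nat.find_spec hG
      refine (Set.not_infinite.1 hspec).subset fun x hx => ⟨hx.1, ?_⟩
      rcases hx.2 with h | ⟨n, hn, hg⟩
      · exact h _
      · exact hn.mono (Nat.find_min' hG hg)
  -- `Q i m` bounds by `m` the sizes of the non-exceptional classes with least element at most `i`,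
  -- so `M i` is their maximum, or 0 if there are none.
  let Q := fun i m => ¬ ∃ x < i + 1, (Rep R x ∧ x ∉ F) ∧ AtLeast R x (m + 1)
  let M := fun i => sInf {m | Q i m}
  have hQex : ∀ i, ∃ m, Q i m := by
    intro i
    have : ∀ x, ∃ m, (Rep R x ∧ x ∉ F) → ¬ AtLeast R x m := by
      intro x
      by_cases hx : Rep R x ∧ x ∉ F
      · have h2 := hx.2
        simp only [F, Set.mem_ofPred_eq, not_and, not_or] at h2
        obtain ⟨m, hm⟩ := not_forall.1 (h2 hx.1).1
        exact ⟨m, fun _ => hm⟩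
      · exact ⟨0, fun h => absurd h hx⟩
    choose m hm using this
    refine ⟨(Finset.range (i + 1)).sup m, ?_⟩
    rintro ⟨x, hx, hxF, h⟩
    have := Finset.le_sup (f := m) (Finset.mem_range.2 hx)
    exact hm x hxF (h.mono (by omega))
  have hQM : ∀ i, Q i (M i) := fun i => Nat.sInf_mem (hQex i)
  have hMmin : ∀ i m, m < M i → ¬ Q i m := fun i m h => Nat.notMem_of_lt_sInf h
  have hMmono : Monotone M := fun i j hij => Nat.sInf_le (by
    rintro ⟨x, hx, h⟩
    exact hQM j ⟨x, by omega, h⟩)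
  let D := fun m b => (Rep S b ∧ b ∉ t '' F) ∧ AtLeast S b m
  have hDinf : ∀ i, Rep R i → i ∉ F → (Set.ofPred (D (M i))).Infinite := by
    intro i hi hiF
    -- The bound `M i` is attained by a non-exceptional class, so it is good, and `t` carries
    -- infinitely many classes of that size into `S`.
    have hatt : ∃ x, (Rep R x ∧ x ∉ F) ∧ AtLeast R x (M i) := by
      rcases Nat.eq_zero_or_pos (M i) with h0 | hpos
      · exact ⟨i, ⟨hi, hiF⟩, h0 ▸ atLeast_zero R i⟩
      · obtain ⟨x, -, hx, h⟩ := not_not.1 (hMmin i (M i - 1) (by omega))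
        exact ⟨x, hx, by rwa [Nat.sub_add_cancel hpos] at h⟩
    obtain ⟨x, ⟨hx, hxF⟩, hxM⟩ := hatt
    have hgood : Good (M i) := by
      by_contra hg
      exact hxF ⟨hx, .inr ⟨_, hxM, hg⟩⟩
    have h1 := (hgood.image (f := t) (htinj.mono fun y hy => hy.1)).sdiff (hF.image t)
    refine h1.mono ?_
    rintro _ ⟨⟨y, ⟨hy, hyM⟩, rfl⟩, hyF⟩
    exact ⟨⟨ht y hy.1, hyF⟩, htsize y _ hy hyM⟩
  -- The index in the enumeration is `i` itself, so no earlier value of `T` has to be known.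
  let T := fun i => if i ∈ F then t i else Nat.nth (D (M i)) i
  have hTF : ∀ i, i ∈ F → T i = t i := fun i h => if_pos h
  have hTn : ∀ i, i ∉ F → T i = Nat.nth (D (M i)) i := fun i h => if_neg h
  have hTD : ∀ i, Rep R i → i ∉ F → D (M i) (T i) := fun i hi hiF => by
    rw [hTn i hiF]
    exact Nat.nth_mem_of_infinite (hDinf i hi hiF) i
  have hTc : ∀ i, Rep R i → i ∉ F → Nat.count (D (M i)) (T i) = i := fun i hi hiF => by
    rw [hTn i hiF]
    exact Nat.count_nth_of_infinite (hDinf i hi hiF) i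
  refine ⟨T, fun r hr => ?_, fun r n hr hn => ?_, ?_, ?_⟩
  · by_cases hrF : r ∈ F
    · rw [hTF r hrF]; exact ht r hr.1
    · exact (hTD r hr hrF).1.1
  · by_cases hrF : r ∈ F
    · rw [hTF r hrF]; exact htsize r n hr hn
    · refine (hTD r hr hrF).2.mono ?_
      by_contra! hlt
      exact hQM r ⟨r, by omega, ⟨hr, hrF⟩, hn.mono hlt⟩
  -- As `i` grows, `M i` grows and `D (M i)` shrinks. A common value has `i`, respectively `j`,
  -- predecessors in these sets, so a larger index cannot have more predecessors.
  · have hle : ∀ i j, Rep R i → Rep R j → i ∉ F → j ∉ F → T i = T j → i ≤ j → j ≤ i := by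
      intro i j hi hj hiF hjF h hij
      calc j = Nat.count (D (M j)) (T j) := (hTc j hj hjF).symm
        _ ≤ Nat.count (D (M i)) (T j) :=
          Nat.count_mono_left fun k _ hk => ⟨hk.1, hk.2.mono (hMmono hij)⟩
        _ = i := by rw [← h, hTc i hi hiF]
    intro i hi j hj h
    by_cases hiF : i ∈ F <;> by_cases hjF : j ∈ F
    · rw [hTF i hiF, hTF j hjF] at h
      exact htinj hi hj h
    · exact absurd ⟨i, hiF, by rw [← hTF i hiF, h]⟩ (hTD j hj hjF).1.2
    · exact absurd ⟨j, hjF, by rw [← hTF j hjF, h]⟩ (hTD i hi hiF).1.2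
    · rcases le_total i j with hij | hij
      · exact le_antisymm hij (hle i j hi hj hiF hjF h hij)
      · exact le_antisymm (hle j i hj hi hjF hiF h.symm hij) hij
  · have hfinite : ∀ {n : ℕ} {s : Set ℕ}, s.Finite → ∀ {α : Type} [Primcodable α] {u : α → ℕ},
        Computable u → Sig X n fun a => u a ∈ s := fun hs _ _ u hu =>
      .of_computablePred ((ComputablePred.mem_finite hs).comp_computable hu)
    have hcofin : ∀ {n : ℕ} {s : Set ℕ}, s.Finite → ∀ {α : Type} [Primcodable α] {u : α → ℕ},
        Computable u → Sig X n fun a => u a ∉ s := fun hs _ _ u hu =>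
      .of_computablePred ((ComputablePred.mem_finite hs).comp_computable hu).not
    have hnQ : Sig X 1 fun p : ℕ × ℕ => ¬ Q p.1 p.2 := by
      refine Sig.of_iff (.bex (f := fun p : ℕ × ℕ => p.1 + 1)
        (P := fun p x => (Rep R x ∧ x ∉ F) ∧ AtLeast R x (p.2 + 1)) (by fun_prop)
        (.and (.and ((sig_rep hR).not_of_zero.comp (by fun_prop)) (hcofin hF (by fun_prop)))
        ((sig_atLeast hR).comp (f := fun q : (ℕ × ℕ) × ℕ => (q.2, q.1.2 + 1)) (by fun_prop))))
        fun p => not_not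
    have hD : Sig X 1 fun p : ℕ × ℕ => D p.1 p.2 :=
      .and (.and ((sig_rep hS).not_of_zero.comp (by fun_prop))
        (hcofin (hF.image t) (by fun_prop)))
        ((sig_atLeast hS).comp (f := fun q : ℕ × ℕ => (q.2, q.1)) (by fun_prop))
    have hDn : Sig X 2 fun p : ℕ × ℕ => ¬ D p.1 p.2 := .of_not (hD.of_iff fun _ => not_not)
    -- The `m` here is `M i`: `Q` is `Π₁`, and its failure below `m` is `Σ₁`.
    have key : Sig X 2 fun p : ℕ × ℕ => Rep R p.1 ∧
        (Nat.pair p.1 p.2 ∈ (fun i => Nat.pair i (t i)) '' F ∨ (p.1 ∉ F ∧ ∃ m,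
          (Q p.1 m ∧ ∀ m' < m, ¬ Q p.1 m') ∧ D m p.2 ∧ Nat.count (D m) p.2 = p.1)) := by
      refine .and ((sig_rep hR).not_of_zero.comp (by fun_prop)) (.or
        (hfinite (hF.image _) (by fun_prop)) (.and (hcofin hF (by fun_prop)) (.ex (.and (.and
        ((Sig.of_not hnQ).comp (f := fun q : (ℕ × ℕ) × ℕ => (q.1.1, q.2)) (by fun_prop))
        (.ball (by fun_prop) (hnQ.succ.comp (f := fun q : ((ℕ × ℕ) × ℕ) × ℕ => (q.1.1.1, q.2))
          (by fun_prop))))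
        (.and (hD.succ.comp (f := fun q : (ℕ × ℕ) × ℕ => (q.2, q.1.2)) (by fun_prop))
        (Sig.count_eq (P := fun (q : (ℕ × ℕ) × ℕ) i => D q.2 i) (f := fun q => q.1.2)
          (g := fun q => q.1.1)
          (hD.succ.comp (f := fun q : ((ℕ × ℕ) × ℕ) × ℕ => (q.1.2, q.2)) (by fun_prop))
          (hDn.comp (f := fun q : ((ℕ × ℕ) × ℕ) × ℕ => (q.1.2, q.2)) (by fun_prop))
          (by fun_prop) (by fun_prop)))))))
    refine key.of_iff fun ⟨i, d⟩ => and_congr_right fun (hi : Rep R i) => ?_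
    simp only [Set.mem_image, Nat.pair_eq_pair]
    by_cases hiF : i ∈ F
    · rw [hTF i hiF]
      constructor
      · rintro rfl
        exact .inl ⟨i, hiF, rfl, rfl⟩
      · rintro (⟨_, _, rfl, rfl⟩ | ⟨h, -⟩)
        · rfl
        · exact absurd hiF h
    · constructor
      · rintro rfl
        exact .inr ⟨hiF, M i, ⟨hQM i, fun m hm => hMmin i m hm⟩, hTD i hi hiF, hTc i hi hiF⟩
      · rintro (⟨_, h, rfl, rfl⟩ | ⟨-, m, ⟨hm, hmin⟩, hd, hc⟩)
        · exact absurd h hiF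
        · have hmM : m = M i := le_antisymm
            (not_lt.1 fun h => hmin _ h (hQM i)) (Nat.sInf_le hm)
          subst hmM
          have h := Nat.nth_count hd
          rwa [hc, ← hTn i hiF] at h

theorem exists_sig_isEmb [Std.Symm R] [IsTrans ℕ R] [Std.Symm S] [IsTrans ℕ S]
    (hR : Sig X 0 fun p : ℕ × ℕ => R p.1 p.2) (hS : Sig X 0 fun p : ℕ × ℕ => S p.1 p.2)
    {e : ℕ → ℕ} (he : IsEmb R S e) (hfin : {x | Rep R x ∧ ∀ n, AtLeast R x n}.Finite) :
    ∃ f, IsEmb R S f ∧ Sig X 2 fun p : ℕ × ℕ => R p.1 p.1 ∧ f p.1 = p.2 := by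
  obtain ⟨T, h1, h2, h3, h4⟩ := exists_rep_map hR hS he hfin
  exact exists_isEmb_of_rep_map hR hS h1 h2 h3 h4

end PER

/-! ### Finitely many infinite classes give relative categoricity. -/

namespace EquivStructure

variable {A B : EquivStructure}

/-- The relation of `A`, as a partial equivalence relation on `ℕ`. -/
def Rel (A : EquivStructure) (x y : ℕ) : Prop :=
  ∃ (hx : x ∈ A.carrier) (hy : y ∈ A.carrier), A.E ⟨x, hx⟩ ⟨y, hy⟩

instance : Std.Symm A.Rel := ⟨fun _ _ ⟨hx, hy, h⟩ => ⟨hy, hx, A.setoid.symm h⟩⟩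

instance : IsTrans ℕ A.Rel :=
  ⟨fun _ _ _ ⟨hx, _, h⟩ ⟨_, hz, h'⟩ => ⟨hx, hz, A.setoid.trans h h'⟩⟩

theorem rel_self_iff {x : ℕ} : A.Rel x x ↔ x ∈ A.carrier :=
  ⟨fun h => h.1, fun h => ⟨h, h, A.setoid.refl _⟩⟩

theorem rel_coe_iff {x y : A.carrier} : A.Rel x y ↔ A.E x y :=
  ⟨fun h => h.2.2, fun h => ⟨x.2, y.2, h⟩⟩

theorem rel_iff_mem_atomicDiagram {x y : ℕ} :
    A.Rel x y ↔ Nat.pair 2 (Nat.pair x y) ∈ A.atomicDiagram := by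
  constructor
  · rintro ⟨hx, hy, h⟩
    exact ⟨⟨x, hx⟩, ⟨y, hy⟩, .inr (.inr (.inl ⟨rfl, h⟩))⟩
  · rintro ⟨a, b, h⟩
    simp only [Nat.pair_eq_pair, OfNat.ofNat_ne_zero, OfNat.ofNat_ne_one, false_and, true_and,
      false_or, Nat.reduceEqDiff, or_false] at h
    obtain ⟨⟨rfl, rfl⟩, h⟩ := h
    exact rel_coe_iff.2 h

theorem sig_rel_of_atomicDiagram {X : Set ℕ} (h : Sig X 0 fun k => k ∈ A.atomicDiagram) :
    Sig X 0 fun p : ℕ × ℕ => A.Rel p.1 p.2 :=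
  (h.comp (f := fun p : ℕ × ℕ => Nat.pair 2 (Nat.pair p.1 p.2)) (by fun_prop)).of_iff
    fun _ => rel_iff_mem_atomicDiagram

theorem sig_left_turingJoin (X Y : Set ℕ) : Sig (turingJoin X Y) 0 fun k => k ∈ X :=
  (Sig.comp (n := 0) (DecidableIn.oracle _) (f := fun k : ℕ => 2 * k) (by fun_prop)).of_iff
    fun k => ⟨fun h => .inl ⟨k, h, rfl⟩, by
      rintro (⟨n, hn, h⟩ | ⟨n, hn, h⟩)
      · rwa [show k = n by omega]
      · omega⟩

theorem sig_right_turingJoin (X Y : Set ℕ) : Sig (turingJoin X Y) 0 fun k => k ∈ Y :=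
  (Sig.comp (n := 0) (DecidableIn.oracle _) (f := fun k : ℕ => 2 * k + 1) (by fun_prop)).of_iff
    fun k => ⟨fun h => .inr ⟨k, h, rfl⟩, by
      rintro (⟨n, hn, h⟩ | ⟨n, hn, h⟩)
      · omega
      · rwa [show k = n by omega]⟩

open Classical in
/-- An embedding as a function on `ℕ`, with the value `0` outside of the universe. -/
noncomputable def Embedding.toNat (f : Embedding A B) (x : ℕ) : ℕ :=
  if h : x ∈ A.carrier then f ⟨x, h⟩ else 0

theorem Embedding.toNat_coe (f : Embedding A B) (x : A.carrier) : f.toNat x = f x := by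
  simp [toNat]

theorem Embedding.isEmb (f : Embedding A B) : PER.IsEmb A.Rel B.Rel f.toNat where
  rel_iff x y hx hy := by
    lift x to A.carrier using rel_self_iff.1 hx
    lift y to A.carrier using rel_self_iff.1 hy
    rw [f.toNat_coe, f.toNat_coe, rel_coe_iff, rel_coe_iff, f.map_rel_iff]
  injOn x hx y hy h := by
    lift x to A.carrier using rel_self_iff.1 hx
    lift y to A.carrier using rel_self_iff.1 hy
    rw [f.toNat_coe, f.toNat_coe] at h
    rw [f.injective (Subtype.ext h)]

theorem exists_embedding_of_isEmb {f : ℕ → ℕ} (hf : PER.IsEmb A.Rel B.Rel f) :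
    ∃ g : Embedding A B, ∀ x : A.carrier, (g x : ℕ) = f x := by
  have h : ∀ x : A.carrier, A.Rel x x := fun x => rel_self_iff.2 x.2
  exact ⟨⟨⟨fun x => ⟨f x, rel_self_iff.1 ((hf.rel_iff x x (h x) (h x)).2 (h x))⟩,
    fun x y hxy => Subtype.ext (hf.injOn (h x) (h y) (congrArg Subtype.val hxy))⟩,
    fun {x y} => by
      rw [← rel_coe_iff, ← rel_coe_iff]
      exact hf.rel_iff x y (h x) (h y)⟩, fun x => rfl⟩

/-- `A` has only finitely many infinite classes. -/
def FinitelyManyInfinite (A : EquivStructure) : Prop :=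
  {x | PER.Rep A.Rel x ∧ ∀ n, PER.AtLeast A.Rel x n}.Finite

/-- An embedding sends distinct infinite classes into distinct infinite classes. -/
theorem FinitelyManyInfinite.of_embedding (hA : A.FinitelyManyInfinite) (g : Embedding B A) :
    B.FinitelyManyInfinite := by
  have hex : ∀ x, B.Rel x x → ∃ r, PER.Rep A.Rel r ∧ A.Rel r (g.toNat x) := fun x hx =>
    PER.exists_rep ((g.isEmb.rel_iff x x hx hx).2 hx)
  choose! t ht hte using hex
  refine Set.Finite.of_finite_image (f := t) (Set.Finite.subset (id hA :
    {x | PER.Rep A.Rel x ∧ ∀ n, PER.AtLeast A.Rel x n}.Finite) ?_) (fun x hx y hy h => ?_)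
  · rintro _ ⟨x, ⟨hx, h⟩, rfl⟩
    exact ⟨ht x hx.1, fun n => (g.isEmb.atLeast hx.1 (h n)).congr (symm (hte x hx.1))⟩
  · have h1 := hte x hx.1.1
    rw [h] at h1
    exact hx.1.eq hy.1
      ((g.isEmb.rel_iff x y hx.1.1 hy.1.1).1 (_root_.trans (symm h1) (hte y hy.1.1)))

/-- A function with decidable domain and `Σ₂` graph has a `Δ₂` graph: a pair lies outside if its
first entry is outside the domain or has a different value. -/
theorem FinitelyManyInfinite.exists_isDelta {X : Set ℕ} (hA : A.FinitelyManyInfinite)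
    (hAX : Sig X 0 fun p : ℕ × ℕ => A.Rel p.1 p.2) (hBX : Sig X 0 fun p : ℕ × ℕ => B.Rel p.1 p.2)
    (e : Embedding A B) : ∃ f : Embedding A B, IsDelta X 2 f.graph := by
  obtain ⟨f, hf, hgraph⟩ := PER.exists_sig_isEmb hAX hBX e.isEmb hA
  obtain ⟨g, hg⟩ := exists_embedding_of_isEmb hf
  have hmem : ∀ k, k ∈ g.graph ↔ A.Rel k.unpair.1 k.unpair.1 ∧ f k.unpair.1 = k.unpair.2 := by
    intro k
    constructor
    · rintro ⟨x, rfl⟩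
      simp [hg, rel_self_iff]
    · rintro ⟨hx, h⟩
      refine ⟨⟨_, rel_self_iff.1 hx⟩, ?_⟩
      rw [hg, h, Nat.pair_unpair]
  refine ⟨g, isSigma_iff_sig.2 ((hgraph.comp (f := fun k : ℕ => k.unpair) (by fun_prop)).of_iff
    hmem), isSigma_iff_sig.2 (Sig.of_iff (.or (hAX.not_zero.not_of_zero.comp
    (f := fun k : ℕ => (k.unpair.1, k.unpair.1)) (by fun_prop)) (.ex (P := fun k y =>
    (A.Rel k.unpair.1 k.unpair.1 ∧ f k.unpair.1 = y) ∧ y ≠ k.unpair.2) (.and (hgraph.comp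
    (f := fun q : ℕ × ℕ => (q.1.unpair.1, q.2)) (by fun_prop))
    (.ne_nat (f := fun q : ℕ × ℕ => q.2) (g := fun q => q.1.unpair.2) (by fun_prop)
      (by fun_prop))))) fun k => ?_)⟩
  rw [Set.mem_compl_iff, hmem, not_and_or]
  by_cases hk : A.Rel k.unpair.1 k.unpair.1
  · simp [hk]
  · simp [hk]

theorem FinitelyManyInfinite.relativelyDelta (hA : A.FinitelyManyInfinite) :
    A.RelativelyDeltaBiembCategorical 2 := by
  rintro B ⟨⟨f⟩, ⟨g⟩⟩
  have hAX := sig_rel_of_atomicDiagram (sig_left_turingJoin A.atomicDiagram B.atomicDiagram)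
  have hBX := sig_rel_of_atomicDiagram (sig_right_turingJoin A.atomicDiagram B.atomicDiagram)
  exact ⟨hA.exists_isDelta hAX hBX f, (hA.of_embedding g).exists_isDelta hBX hAX g⟩

end EquivStructure

/-! ### From `Σ₂` graphs to `0'`-computable embeddings. -/

theorem DecidableIn.computablePred {X : Set ℕ} (hX : ComputablePred fun n => n ∈ X)
    {α : Type} [Primcodable α] {P : α → Prop} (hP : DecidableIn X P) : ComputablePred P := by
  classical
  obtain ⟨g, hg, h⟩ := hP
  have hg' : Computable g := by
    refine Partrec.nat_iff.2 (hg.partrec_of_oracle ?_)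
    rintro _ rfl
    refine Partrec.nat_iff.1 ((Computable.cond hX.decide (Computable.const 1)
      (Computable.const 0)).partrec.of_eq fun n => ?_)
    by_cases hn : n ∈ X <;> simp [charFn, hn]
  exact (ComputablePred.eq_nat (hg'.comp Computable.encode) (Computable.const 0)).of_eq
    fun a => (h a).symm

theorem REPred.exists_of_computablePred {α : Type} [Primcodable α] {P : α × ℕ → Prop}
    (hP : ComputablePred P) : REPred fun a => ∃ b, P (a, b) := by
  classical
  have h : Partrec fun a => Nat.rfind ((fun b => decide (P (a, b)) : ℕ → Bool) : ℕ →. Bool) :=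
    Partrec.rfind hP.decide.partrec.to₂
  refine h.dom_re.of_eq fun a => ?_
  rw [Nat.rfind_dom]
  simp

open Nat.Partrec (Code) in
/-- The normal form for `Σ₂` sets of natural numbers. -/
theorem Sig.exists_code {X : Set ℕ} (hX : ComputablePred fun n => n ∈ X) {P : ℕ → Prop}
    (hP : Sig X 2 P) : ∃ c : Code, ∀ a, P a ↔ ∃ b, ¬ (c.eval (Nat.pair a b)).Dom := by
  obtain ⟨Q, ⟨R, hR, hQ⟩, hP⟩ := hP
  have hre : REPred fun p : ℕ × ℕ => ∃ c, R (p, c) := by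
    refine REPred.exists_of_computablePred ((DecidableIn.computablePred hX hR).not.of_eq ?_)
    simp
  have h2 : Partrec fun k : ℕ =>
      ((Part.assert (∃ c, R (k.unpair, c)) fun _ => Part.some ()).map fun _ => 0 : Part ℕ) :=
    Partrec.map (Partrec.comp hre (g := fun k : ℕ => k.unpair) (by fun_prop))
      (Computable.const 0).to₂
  obtain ⟨c, hc⟩ := Code.exists_code.1 (Partrec.nat_iff.1 h2)
  refine ⟨c, fun a => (hP a).trans (exists_congr fun b => ?_)⟩
  have h : (c.eval (Nat.pair a b)).Dom ↔ ∃ c, R ((a, b), c) := by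
    rw [hc]
    simp [Part.assert]
  rw [h, ← hQ (a, b), not_not]

open Nat.Partrec (Code) in
-- The program `c.comp (Code.const k)` ignores its input, so running it on its own index amounts to
-- running `c` on `k`.
theorem exists_computable_mem_haltingSet_iff (c : Code) :
    ∃ h : ℕ → ℕ, Computable h ∧ ∀ k, h k ∈ haltingSet ↔ (c.eval k).Dom := by
  refine ⟨fun k => Encodable.encode (c.comp (Code.const k)), ?_, fun k => ?_⟩
  · exact (Primrec.encode.comp (Code.primrec₂_comp.comp (Primrec.const c)
      Code.primrec_const)).to_comp
  · simp only [haltingSet, Set.mem_ofPred_eq, Denumerable.ofNat_encode, Code.eval,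
      Code.eval_const]
    exact iff_of_eq (congrArg Part.Dom (Part.bind_some k c.eval))

namespace EquivStructure

/-- Search with the halting set for a pair of a value `y` and a `Σ₂` witness that `y` is correct,
and return `y`. Outside the universe the search diverges, as it should. -/
theorem Embedding.toPFun_turingReducible {A B : EquivStructure} {X : Set ℕ}
    (hX : ComputablePred fun n => n ∈ X) {f : Embedding A B} (hf : IsSigma X 2 f.graph) :
    f.toPFun ≤ᵀ charFn haltingSet := by
  obtain ⟨c, hc⟩ := (isSigma_iff_sig.1 hf).exists_code hX
  obtain ⟨h, hh, hhalt⟩ := exists_computable_mem_haltingSet_iff c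
  rw [TuringReducible, RecursiveIn.iff_nat]
  classical
  let G : ℕ → ℕ := fun n =>
    if h (Nat.pair (Nat.pair n.unpair.1 n.unpair.2.unpair.1) n.unpair.2.unpair.2) ∈ haltingSet
    then 1 else 0
  have hG : ∀ n m, G (Nat.pair n m) = 0 ↔
      h (Nat.pair (Nat.pair n m.unpair.1) m.unpair.2) ∉ haltingSet := fun n m => by simp [G]
  have hK : TotalRecursiveIn haltingSet fun n => if n ∈ haltingSet then 1 else 0 :=
    (Nat.RecursiveIn.oracle _ (Set.mem_singleton _)).of_eq fun n => by simp only [charFn]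
  have h1 : TotalRecursiveIn haltingSet G := hK.comp (.of_computable (by fun_prop))
  have h2 := Nat.RecursiveIn.comp .left (Nat.RecursiveIn.rfind h1)
  have hgraph : ∀ x y, y ∈ f.toPFun x ↔ Nat.pair x y ∈ f.graph := by
    intro x y
    constructor
    · rintro ⟨hx, rfl⟩
      exact ⟨⟨x, hx⟩, rfl⟩
    · rintro ⟨⟨a, ha⟩, h⟩
      obtain ⟨rfl, rfl⟩ := Nat.pair_eq_pair.1 h
      exact ⟨ha, rfl⟩
  have hmem : ∀ n m : ℕ, h (Nat.pair (Nat.pair n m.unpair.1) m.unpair.2) ∉ haltingSet →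
      m.unpair.1 ∈ f.toPFun n := fun n m hm => by
    rw [hgraph, hc]
    exact ⟨_, fun hd => hm ((hhalt _).2 hd)⟩
  refine h2.of_eq fun n => Part.ext fun y => ?_
  change y ∈ (Nat.rfind ((fun m => decide (G (Nat.pair n m) = 0) : ℕ → Bool) : ℕ →. Bool)).bind
    (fun m => Part.some m.unpair.1) ↔ _
  rw [Part.mem_bind_iff]
  constructor
  · rintro ⟨m, hm, hy⟩
    have h3 := Nat.rfind_spec hm
    rw [PFun.coe_val, Part.mem_some_iff, eq_comm, decide_eq_true_iff, hG] at h3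
    rw [Part.mem_some_iff.1 hy]
    exact hmem n m h3
  · intro hy
    have hex : ∃ m, G (Nat.pair n m) = 0 := by
      have hy' := hy
      rw [hgraph, hc] at hy'
      obtain ⟨b, hb⟩ := hy'
      exact ⟨Nat.pair y b, (hG _ _).2 fun h => hb ((hhalt _).1 (by simpa using h))⟩
    refine ⟨Nat.find hex, Nat.mem_rfind.2 ⟨?_, fun {m} hm => ?_⟩, Part.mem_some_iff.2
      (Part.mem_unique hy (hmem _ _ ((hG _ _).1 (Nat.find_spec hex))))⟩
    · simpa using Nat.find_spec hex
    · simpa using Nat.find_min hex hm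

theorem computablePred_turingJoin {X Y : Set ℕ} (hX : ComputablePred fun n => n ∈ X)
    (hY : ComputablePred fun n => n ∈ Y) : ComputablePred fun n => n ∈ turingJoin X Y := by
  have h : Sig ∅ 0 fun n => n ∈ turingJoin X Y := by
    refine Sig.of_iff (.or (.bex (f := fun n => n + 1) (P := fun k n => n ∈ X ∧ k = 2 * n)
      (by fun_prop) (.and (.of_computablePred (hX.comp_computable (by fun_prop)))
      (.eq_nat (by fun_prop) (by fun_prop))))
      (.bex (f := fun n => n + 1) (P := fun k n => n ∈ Y ∧ k = 2 * n + 1)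
      (by fun_prop) (.and (.of_computablePred (hY.comp_computable (by fun_prop)))
      (.eq_nat (by fun_prop) (by fun_prop))))) fun k => or_congr ?_ ?_
    · exact exists_congr fun n => ⟨fun h => ⟨by omega, h⟩, fun h => h.2⟩
    · exact exists_congr fun n => ⟨fun h => ⟨by omega, h⟩, fun h => h.2⟩
  exact DecidableIn.computablePred (ComputablePred.mem_finite Set.finite_empty) h

theorem RelativelyDeltaBiembCategorical.deltaTwo {A : EquivStructure} (hA : A.IsComputable)
    (h : A.RelativelyDeltaBiembCategorical 2) : A.DeltaTwoBiembCategorical := by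
  intro B hB hAB
  obtain ⟨⟨f, hf⟩, g, hg⟩ := h B hAB
  have hX := computablePred_turingJoin hA hB
  exact ⟨⟨f, f.toPFun_turingReducible hX hf.1⟩, g, g.toPFun_turingReducible hX hg.1⟩

end EquivStructure

/-! ### `Σ₂` graphs of `0'`-computable functions, and a simple `Σ₂` set. -/

open Nat.Partrec (Code)

theorem sig_eval_dom (X : Set ℕ) : Sig X 1 fun p : Code × ℕ => (p.1.eval p.2).Dom := by
  have h : Computable fun q : (Code × ℕ) × ℕ => (Code.evaln q.2 q.1.1 q.1.2).isSome :=
    (Primrec.option_isSome.comp (Code.primrec_evaln.comp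
      ((Primrec.snd.pair (Primrec.fst.comp Primrec.fst)).pair
        (Primrec.snd.comp Primrec.fst)))).to_comp
  refine (Sig.ex (P := fun (p : Code × ℕ) k => (Code.evaln k p.1 p.2).isSome)
    (.of_computablePred (ComputablePred.computable_iff.2 ⟨_, h, rfl⟩))).of_iff fun p => ?_
  simp only [Part.dom_iff_mem, Code.evaln_complete, Option.isSome_iff_exists, Option.mem_def]
  exact exists_comm

theorem sig_haltingSet (X : Set ℕ) : Sig X 1 fun n => n ∈ haltingSet :=
  (sig_eval_dom X).comp (f := fun n : ℕ => (Denumerable.ofNat Code n, n)) (by fun_prop)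

/-- The graph of a function that is partial recursive in the halting set is `Σ₂`. -/
theorem Nat.RecursiveIn.sig_graph {X : Set ℕ} {f : ℕ →. ℕ}
    (hf : Nat.RecursiveIn {charFn haltingSet} f) : Sig X 2 fun p : ℕ × ℕ => p.2 ∈ f p.1 := by
  induction hf with
  | zero =>
    exact (Sig.eq_nat (f := fun p : ℕ × ℕ => p.2) (g := fun _ => 0) (by fun_prop)
      (by fun_prop)).of_iff fun p => Part.mem_some_iff
  | succ =>
    exact (Sig.eq_nat (f := fun p : ℕ × ℕ => p.2) (g := fun p => p.1 + 1) (by fun_prop)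
      (by fun_prop)).of_iff fun p => Part.mem_some_iff
  | left =>
    exact (Sig.eq_nat (f := fun p : ℕ × ℕ => p.2) (g := fun p => p.1.unpair.1) (by fun_prop)
      (by fun_prop)).of_iff fun p => Part.mem_some_iff
  | right =>
    exact (Sig.eq_nat (f := fun p : ℕ × ℕ => p.2) (g := fun p => p.1.unpair.2) (by fun_prop)
      (by fun_prop)).of_iff fun p => Part.mem_some_iff
  | oracle g hg =>
    rw [Set.mem_singleton_iff.1 hg]
    have h : Sig X 2 fun p : ℕ × ℕ =>
        (p.1 ∈ haltingSet ∧ p.2 = 1) ∨ (p.1 ∉ haltingSet ∧ p.2 = 0) :=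
      .or (.and ((sig_haltingSet X).succ.comp (by fun_prop)) (.eq_nat (by fun_prop) (by fun_prop)))
        (.and ((Sig.of_not ((sig_haltingSet X).of_iff fun _ => not_not)).comp
          (P := fun n => n ∉ haltingSet) (by fun_prop)) (.eq_nat (by fun_prop) (by fun_prop)))
    refine h.of_iff fun p => ?_
    by_cases hp : p.1 ∈ haltingSet <;> simp [charFn, hp]
  | @pair f h _ _ ihf ihh =>
    refine (Sig.and (ihf.comp (f := fun p : ℕ × ℕ => (p.1, p.2.unpair.1)) (by fun_prop))
      (ihh.comp (f := fun p : ℕ × ℕ => (p.1, p.2.unpair.2)) (by fun_prop))).of_iff fun p => ?_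
    simp only [Seq.seq, Part.map_eq_map, Part.bind_map, Part.mem_bind_iff, Part.mem_map_iff]
    constructor
    · rintro ⟨a, ha, b, hb, h⟩
      simp [← h, ha, hb]
    · rintro ⟨ha, hb⟩
      exact ⟨_, ha, _, hb, Nat.pair_unpair _⟩
  | @comp f h _ _ ihf ihh =>
    refine (Sig.ex (P := fun (p : ℕ × ℕ) z => z ∈ h p.1 ∧ p.2 ∈ f z) (.and
      (ihh.comp (f := fun p : (ℕ × ℕ) × ℕ => (p.1.1, p.2)) (by fun_prop))
      (ihf.comp (f := fun p : (ℕ × ℕ) × ℕ => (p.2, p.1.2)) (by fun_prop)))).of_iff fun p => ?_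
    exact Part.mem_bind_iff
  -- The witness is the list of all intermediate values of the recursion.
  | @prec f h _ _ ihf ihh =>
    refine (Sig.ex_denumerable (δ := List ℕ) (P := fun (p : ℕ × ℕ) l =>
      (l.getI 0 ∈ f p.1.unpair.1 ∧ l.getI p.1.unpair.2 = p.2) ∧ ∀ i < p.1.unpair.2,
        l.getI (i + 1) ∈ h (Nat.pair p.1.unpair.1 (Nat.pair i (l.getI i))))
      (.and (.and (ihf.comp (f := fun q : (ℕ × ℕ) × List ℕ => (q.1.1.unpair.1, q.2.getI 0))
        (by fun_prop)) (.eq_nat (by fun_prop) (by fun_prop)))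
      (.ball (by fun_prop) (ihh.comp (f := fun q : ((ℕ × ℕ) × List ℕ) × ℕ =>
        (Nat.pair q.1.1.1.unpair.1 (Nat.pair q.2 (q.1.2.getI q.2)), q.1.2.getI (q.2 + 1)))
        (by fun_prop))))).of_iff fun ⟨p, y⟩ => ?_
    simp only
    generalize p.unpair.1 = a
    generalize p.unpair.2 = n
    constructor
    · intro hy
      -- Fixing the length makes an appended value land at index `n + 1`, with the earlier entries
      -- unchanged.
      suffices H : ∃ l : List ℕ, l.length = n + 1 ∧ (l.getI 0 ∈ f a ∧ l.getI n = y) ∧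
          ∀ i < n, l.getI (i + 1) ∈ h (Nat.pair a (Nat.pair i (l.getI i))) by
        obtain ⟨l, -, hl⟩ := H
        exact ⟨l, hl⟩
      induction n generalizing y with
      | zero => exact ⟨[y], rfl, ⟨hy, rfl⟩, fun i hi => absurd hi (by omega)⟩
      | succ n ih =>
        obtain ⟨z, hz, hy⟩ := Part.mem_bind_iff.1 hy
        obtain ⟨l, hlen, ⟨h0, hn⟩, hl⟩ := ih z hz
        have hlt : ∀ i < n + 1, (l ++ [y]).getI i = l.getI i := fun i hi => by
          rw [List.getI_append _ _ _ (by omega)]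
        have hlast : (l ++ [y]).getI (n + 1) = y := by
          rw [List.getI_append_right _ _ _ (by omega)]
          simp [hlen]
        refine ⟨l ++ [y], by simp [hlen], ⟨by rwa [hlt 0 (by omega)], hlast⟩, fun i hi => ?_⟩
        rcases Nat.lt_succ_iff_lt_or_eq.1 hi with hi' | rfl
        · rw [hlt _ (by omega), hlt _ (by omega)]
          exact hl i hi'
        · rw [hlast, hlt _ (by omega), hn]
          exact hy
    · rintro ⟨l, ⟨h0, rfl⟩, hl⟩
      induction n with
      | zero => exact h0
      | succ n ih =>
        exact Part.mem_bind_iff.2 ⟨_, ih fun i hi => hl i (by omega), hl n (by omega)⟩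
  | @rfind f _ ihf =>
    refine (Sig.and (ihf.comp (f := fun p : ℕ × ℕ => (Nat.pair p.1 p.2, 0)) (by fun_prop))
      (.ball (f := fun p : ℕ × ℕ => p.2)
        (P := fun p i => ∃ z, z ∈ f (Nat.pair p.1 i) ∧ z ≠ 0) (by fun_prop)
        (.ex (.and (ihf.comp (f := fun p : ((ℕ × ℕ) × ℕ) × ℕ => (Nat.pair p.1.1.1 p.1.2, p.2))
          (by fun_prop)) (.ne_nat (by fun_prop) (by fun_prop)))))).of_iff fun p => ?_
    refine Nat.mem_rfind.trans (and_congr ((Part.mem_map_iff _).trans ?_)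
      (forall₂_congr fun i _ => (Part.mem_map_iff _).trans ?_))
    · simp
    · simp

/-- There is a `Σ₂` set that is simple among the `Σ₂` sets. -/
theorem exists_sig_two_simple : ∃ S : ℕ → Prop, Sig ∅ 2 S ∧ {x | ¬ S x}.Infinite ∧
    ∀ W : ℕ → Prop, Sig ∅ 2 W → {x | W x}.Infinite → ∃ x, W x ∧ S x := by
  classical
  -- Post's construction: each `c`, read as a `Σ₂` set, puts into `S` at most one of its elements,
  -- which must exceed twice the code of `c`.
  let Sel : Code → ℕ → Prop := fun c p => (2 * Encodable.encode c < p.unpair.1 ∧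
    ¬ (c.eval p).Dom) ∧ ∀ q < p, q.unpair.1 ≤ 2 * Encodable.encode c ∨ (c.eval q).Dom
  have hSel : ∀ c p q, Sel c p → Sel c q → p = q := by
    have : ∀ c p q, Sel c p → Sel c q → ¬ p < q := by
      intro c p q hp hq hlt
      rcases hq.2 p hlt with h | h
      · exact absurd hp.1.1 (by omega)
      · exact hp.1.2 h
    intro c p q hp hq
    exact le_antisymm (not_lt.1 (this c q p hq hp)) (not_lt.1 (this c p q hp hq))
  refine ⟨fun x => ∃ (c : Code) (b : ℕ), Sel c (Nat.pair x b), ?_, ?_, ?_⟩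
  · have hd := sig_eval_dom ∅
    have hn : Sig ∅ 2 fun p : Code × ℕ => ¬ (p.1.eval p.2).Dom :=
      .of_not (hd.of_iff fun _ => not_not)
    refine .ex_denumerable (.ex (.and (.and (.lt_nat (by fun_prop) (by fun_prop))
      (hn.comp (f := fun q : (ℕ × Code) × ℕ => (q.1.2, Nat.pair q.1.1 q.2)) (by fun_prop)))
      (.ball (by fun_prop) (.or (.le_nat (by fun_prop) (by fun_prop))
        (hd.succ.comp (f := fun q : ((ℕ × Code) × ℕ) × ℕ => (q.1.1.2, q.2)) (by fun_prop))))))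
  · intro hfin
    have hex : ∀ x, (∃ (c : Code) (b : ℕ), Sel c (Nat.pair x b)) →
        ∃ (c : Code), ∃ b, Sel c (Nat.pair x b) := fun x h => h
    choose! c b hcb using hex
    set k := hfin.toFinset.card with hk
    set S : ℕ → Prop := fun x => ∃ (c : Code) (b : ℕ), Sel c (Nat.pair x b)
    -- Elements of `S` up to `2 * k` come from distinct programs with code below `k`. This leaves at
    -- least `k + 1` numbers outside `S`, whereas `k` is the size of the complement.
    have h1 : ((Finset.range (2 * k + 1)).filter S).card ≤ (Finset.range k).card := by
      refine Finset.card_le_card_of_injOn (fun x => Encodable.encode (c x)) (fun x hx => ?_)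
        (fun x hx y hy hxy => ?_)
      · have hx' := Finset.mem_filter.1 hx
        have h2 := (hcb x hx'.2).1.1
        rw [Nat.unpair_pair] at h2
        have h3 := Finset.mem_range.1 hx'.1
        simp only [Finset.coe_range, Set.mem_Iio]
        simp only at h2
        omega
      · have h2 := hcb x (Finset.mem_filter.1 hx).2
        rw [Encodable.encode_injective hxy] at h2
        exact (Nat.pair_eq_pair.1 (hSel _ _ _ h2 (hcb y (Finset.mem_filter.1 hy).2))).1
    have h2 : ((Finset.range (2 * k + 1)).filter fun x => ¬ S x).card ≤ k :=
      Finset.card_le_card fun x hx => hfin.mem_toFinset.2 (Finset.mem_filter.1 hx).2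
    have h3 := Finset.card_filter_add_card_filter_not (s := Finset.range (2 * k + 1)) S
    simp only [Finset.card_range] at h1 h3
    omega
  · intro W hW hinf
    obtain ⟨c, hc⟩ := hW.exists_code (ComputablePred.mem_finite Set.finite_empty)
    have hex : ∃ p : ℕ, 2 * Encodable.encode c < p.unpair.1 ∧ ¬ (c.eval p).Dom := by
      obtain ⟨x, hx, hlt⟩ := hinf.exists_gt (2 * Encodable.encode c)
      obtain ⟨b, hb⟩ := (hc x).1 hx
      exact ⟨Nat.pair x b, by simpa using hlt, hb⟩
    have hspec := Nat.find_spec hex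
    refine ⟨(Nat.find hex).unpair.1, (hc _).2 ⟨(Nat.find hex).unpair.2, ?_⟩, c,
      (Nat.find hex).unpair.2, ?_⟩
    · rw [Nat.pair_unpair]; exact hspec.2
    · rw [Nat.pair_unpair]
      refine ⟨hspec, fun q hq => ?_⟩
      have := Nat.find_min hex hq
      rw [not_and, not_not] at this
      exact or_iff_not_imp_left.2 fun h => this (not_le.1 h)

/-! ### Infinitely many infinite classes contradict `Δ⁰₂` categoricity. -/

namespace PER

/-- Every partial equivalence relation embeds in one with infinitely many infinite classes. -/
theorem exists_isEmb_of_infinite {R S : ℕ → ℕ → Prop} [Std.Symm R] [IsTrans ℕ R] [Std.Symm S]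
    [IsTrans ℕ S] {u : ℕ → ℕ} (hu : ∀ i, (Set.ofPred (R (u i))).Infinite)
    (huu : ∀ i j, R (u i) (u j) → i = j) : ∃ f, IsEmb S R f := by
  choose! rep hrep hrel using fun x (hx : S x x) => exists_rep hx
  -- The target classes are infinite, so `x` itself can be used as its position in the image class.
  have hf : ∀ x, R (u (rep x)) (Nat.nth (R (u (rep x))) x) := fun x =>
    Nat.nth_mem_of_infinite (hu _) x
  have hiff : ∀ x y, S x x → S y y →
      (R (Nat.nth (R (u (rep x))) x) (Nat.nth (R (u (rep y))) y) ↔ S x y) := by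
    intro x y hx hy
    constructor
    · intro h
      have h1 := huu _ _ (_root_.trans (_root_.trans (hf x) h) (symm (hf y)))
      have h2 := hrel x hx
      rw [h1] at h2
      exact _root_.trans (symm h2) (hrel y hy)
    · intro h
      have h1 : rep x = rep y := (hrep x hx).eq (hrep y hy)
        (_root_.trans (_root_.trans (hrel x hx) h) (symm (hrel y hy)))
      have h2 := hf x
      rw [h1] at h2 ⊢
      exact _root_.trans (symm h2) (hf y)
  refine ⟨fun x => Nat.nth (R (u (rep x))) x, hiff, fun x hx y hy h => ?_⟩
  have h1 : S x y := by
    rw [← hiff x y hx hy, ← h]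
    exact _root_.trans (symm (hf x)) (hf x)
  have h2 : rep x = rep y := (hrep x hx).eq (hrep y hy)
    (_root_.trans (_root_.trans (hrel x hx) h1) (symm (hrel y hy)))
  rw [h2] at h
  exact Nat.nth_injective (hu _) h

theorem infinite_of_atLeast {R : ℕ → ℕ → Prop} {x : ℕ} (h : ∀ n, AtLeast R x n) :
    (Set.ofPred (R x)).Infinite := by
  classical
  intro hfin
  obtain ⟨N, hN⟩ := h (hfin.toFinset.card + 1)
  have := Nat.count_le_card hfin N
  have h2 : hfin.toFinset.card + 1 ≤ Nat.count (R x) N := by convert hN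
  omega

end PER

namespace EquivStructure

/-- The structure with the universe `C` in which two pairs are equivalent if they have the same
first component. -/
def ofFst (C : Set ℕ) (hC : ComputablePred fun n => n ∈ C) : EquivStructure where
  carrier := C
  computable_carrier := hC
  setoid := Setoid.comap (fun x : C => (x : ℕ).unpair.1) ⊥

variable {C : Set ℕ} {hC : ComputablePred fun n => n ∈ C}

theorem ofFst_E {x y : (ofFst C hC).carrier} :
    (ofFst C hC).E x y ↔ (x : ℕ).unpair.1 = (y : ℕ).unpair.1 := Iff.rfl

theorem ofFst_rel {x y : ℕ} :
    (ofFst C hC).Rel x y ↔ (x ∈ C ∧ y ∈ C) ∧ x.unpair.1 = y.unpair.1 :=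
  ⟨fun ⟨hx, hy, h⟩ => ⟨⟨hx, hy⟩, h⟩, fun ⟨⟨hx, hy⟩, h⟩ => ⟨hx, hy, h⟩⟩

theorem ofFst_isComputable : (ofFst C hC).IsComputable := by
  have hC' : ∀ {u : ℕ → ℕ}, Computable u → Sig ∅ 0 fun k => u k ∈ C := fun hu =>
    .of_computablePred (hC.comp_computable hu)
  have h : Sig ∅ 0 fun k : ℕ => (k.unpair.2.unpair.1 ∈ C ∧ k.unpair.2.unpair.2 ∈ C) ∧
      ((k.unpair.1 = 0 ∧ k.unpair.2.unpair.1 = k.unpair.2.unpair.2) ∨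
      (k.unpair.1 = 1 ∧ k.unpair.2.unpair.1 ≠ k.unpair.2.unpair.2) ∨
      (k.unpair.1 = 2 ∧ k.unpair.2.unpair.1.unpair.1 = k.unpair.2.unpair.2.unpair.1) ∨
      (k.unpair.1 = 3 ∧ k.unpair.2.unpair.1.unpair.1 ≠ k.unpair.2.unpair.2.unpair.1)) :=
    .and (.and (hC' (by fun_prop)) (hC' (by fun_prop)))
      (.or (.and (.eq_nat (by fun_prop) (by fun_prop)) (.eq_nat (by fun_prop) (by fun_prop)))
      (.or (.and (.eq_nat (by fun_prop) (by fun_prop)) (.ne_nat (by fun_prop) (by fun_prop)))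
      (.or (.and (.eq_nat (by fun_prop) (by fun_prop)) (.eq_nat (by fun_prop) (by fun_prop)))
      (.and (.eq_nat (by fun_prop) (by fun_prop)) (.ne_nat (by fun_prop) (by fun_prop))))))
  refine (DecidableIn.computablePred (ComputablePred.mem_finite Set.finite_empty) h).of_eq
    fun k => ?_
  constructor
  · rintro ⟨⟨hx, hy⟩, h⟩
    refine ⟨⟨_, hx⟩, ⟨_, hy⟩, ?_⟩
    have hk : ∀ i, k.unpair.1 = i → k = Nat.pair i (Nat.pair k.unpair.2.unpair.1
        k.unpair.2.unpair.2) := by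
      rintro i rfl
      simp
    rcases h with ⟨hi, h⟩ | ⟨hi, h⟩ | ⟨hi, h⟩ | ⟨hi, h⟩
    · exact .inl ⟨hk _ hi, Subtype.ext h⟩
    · exact .inr (.inl ⟨hk _ hi, fun e => h (congrArg Subtype.val e)⟩)
    · exact .inr (.inr (.inl ⟨hk _ hi, h⟩))
    · exact .inr (.inr (.inr ⟨hk _ hi, h⟩))
  · rintro ⟨⟨x, hx⟩, ⟨y, hy⟩, h⟩
    have hx' : x ∈ C := hx
    have hy' : y ∈ C := hy
    rcases h with ⟨rfl, h⟩ | ⟨rfl, h⟩ | ⟨rfl, h⟩ | ⟨rfl, h⟩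
    · simpa [hx', hy'] using h
    · simpa [hx', hy'] using h
    · simpa [hx', hy', ofFst_E] using h
    · simpa [hx', hy', ofFst_E] using h

theorem exists_embedding_ofFst (A : EquivStructure)
    (h : {x | {k ∈ C | k.unpair.1 = x}.Infinite}.Infinite) :
    Nonempty (Embedding A (ofFst C hC)) := by
  have hx : ∀ i, {k ∈ C | k.unpair.1 = h.natEmbedding _ i}.Infinite := fun i =>
    (h.natEmbedding _ i).2
  choose u hu using fun i => (hx i).nonempty
  obtain ⟨f, hf⟩ := PER.exists_isEmb_of_infinite (R := (ofFst C hC).Rel) (S := A.Rel) (u := u)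
    (fun i => (hx i).mono fun k hk => ofFst_rel.2 ⟨⟨(hu i).1, hk.1⟩, by rw [(hu i).2, hk.2]⟩)
    (fun i j hij => by
      have := (ofFst_rel.1 hij).2
      rw [(hu i).2, (hu j).2] at this
      exact (h.natEmbedding _).injective (Subtype.ext this))
  exact ⟨(exists_embedding_of_isEmb hf).choose⟩

theorem exists_embedding_of_not_finitelyManyInfinite {A : EquivStructure}
    (hA : ¬ A.FinitelyManyInfinite) (B : EquivStructure) : Nonempty (Embedding B A) := by
  have hA' : {x | PER.Rep A.Rel x ∧ ∀ n, PER.AtLeast A.Rel x n}.Infinite := hA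
  have hx := fun i => (hA'.natEmbedding _ i).2
  obtain ⟨f, hf⟩ := PER.exists_isEmb_of_infinite (R := A.Rel) (S := B.Rel)
    (u := fun i => hA'.natEmbedding _ i) (fun i => PER.infinite_of_atLeast (hx i).2)
    (fun i j hij => (hA'.natEmbedding _).injective
      (Subtype.ext ((hx i).1.eq (hx j).1 hij)))
  exact ⟨(exists_embedding_of_isEmb hf).choose⟩

/-- Every `Π₂` set is the set of the infinite classes of a computable structure. -/
theorem exists_computable_infinite_iff {S : ℕ → Prop} (hS : Sig ∅ 2 S) :
    ∃ C : Set ℕ, (ComputablePred fun n => n ∈ C) ∧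
      ∀ x, {k ∈ C | k.unpair.1 = x}.Infinite ↔ ¬ S x := by
  obtain ⟨c, hc⟩ := hS.exists_code (ComputablePred.mem_finite Set.finite_empty)
  let P : ℕ → ℕ → ℕ → Prop := fun x b t => ∀ i < b, (Code.evaln t c (Nat.pair x i)).isSome
  have hP : ∀ {α : Type} [Primcodable α] {u v w : α → ℕ}, Computable u → Computable v →
      Computable w → Sig ∅ 0 fun a => P (u a) (v a) (w a) := by
    intro α _ u v w hu hv hw
    have h : Computable fun q : ℕ × ℕ => (Code.evaln q.1 c q.2).isSome :=
      (Primrec.option_isSome.comp (Code.primrec_evaln.comp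
        ((Primrec.fst.pair (Primrec.const c)).pair Primrec.snd))).to_comp
    refine .ball hv (Sig.of_computablePred (ComputablePred.computable_iff.2 ⟨_,
      h.comp (f := fun q : ℕ × ℕ => (Code.evaln q.1 c q.2).isSome)
        (g := fun q : α × ℕ => (w q.1, Nat.pair (u q.1) q.2)) (by fun_prop), rfl⟩))
  -- Elements code triples `(x, b, t)`, with `t` the least stage by which `c` has halted on `(x, i)`
  -- for all `i < b`. Each `b` yields at most one `t`, and none once `b` exceeds a point of
  -- divergence.
  let C : Set ℕ := {k | P k.unpair.1 k.unpair.2.unpair.1 k.unpair.2.unpair.2 ∧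
    ∀ t < k.unpair.2.unpair.2, ¬ P k.unpair.1 k.unpair.2.unpair.1 t}
  have hC : Sig ∅ 0 fun k => k ∈ C :=
    .and (hP (by fun_prop) (by fun_prop) (by fun_prop))
      (.ball (by fun_prop) (hP (by fun_prop) (by fun_prop) (by fun_prop)).not_zero)
  refine ⟨C, DecidableIn.computablePred (ComputablePred.mem_finite Set.finite_empty) hC,
    fun x => ?_⟩
  constructor
  · intro hinf hSx
    obtain ⟨b, hb⟩ := (hc x).1 hSx
    refine hinf (Set.Finite.of_finite_image (f := fun k => k.unpair.2.unpair.1)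
      ((Set.finite_Iic b).subset ?_) ?_)
    · rintro _ ⟨k, ⟨hk, rfl⟩, rfl⟩
      simp only [Set.mem_Iic]
      by_contra! hlt
      obtain ⟨y, hy⟩ := Option.isSome_iff_exists.1 (hk.1 b hlt)
      exact hb (Part.dom_iff_mem.2 ⟨y, Code.evaln_sound hy⟩)
    · rintro k ⟨hk, hkx⟩ l ⟨hl, hlx⟩ hkl
      have h1 : k.unpair.1 = l.unpair.1 := hkx.trans hlx.symm
      have h2 : k.unpair.2.unpair.1 = l.unpair.2.unpair.1 := hkl
      have h3 : k.unpair.2.unpair.2 = l.unpair.2.unpair.2 := by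
        rcases lt_trichotomy k.unpair.2.unpair.2 l.unpair.2.unpair.2 with h | h | h
        · exact absurd hk.1 (by rw [h1, h2]; exact hl.2 _ h)
        · exact h
        · exact absurd hl.1 (by rw [← h1, ← h2]; exact hk.2 _ h)
      rw [← Nat.pair_unpair k, ← Nat.pair_unpair l, h1, ← Nat.pair_unpair k.unpair.2,
        ← Nat.pair_unpair l.unpair.2, h2, h3]
  · intro hSx
    have hex : ∀ b, ∃ t, P x b t := by
      intro b
      have : ∀ i, ∃ t, (Code.evaln t c (Nat.pair x i)).isSome := by
        intro i
        have hd : (c.eval (Nat.pair x i)).Dom := by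
          by_contra hd
          exact hSx ((hc x).2 ⟨i, hd⟩)
        obtain ⟨y, hy⟩ := Part.dom_iff_mem.1 hd
        obtain ⟨t, ht⟩ := Code.evaln_complete.1 hy
        exact ⟨t, Option.isSome_iff_exists.2 ⟨y, ht⟩⟩
      choose t ht using this
      refine ⟨(Finset.range b).sup t, fun i hi => ?_⟩
      obtain ⟨y, hy⟩ := Option.isSome_iff_exists.1 (ht i)
      exact Option.isSome_iff_exists.2
        ⟨y, Code.evaln_mono (Finset.le_sup (f := t) (Finset.mem_range.2 hi)) hy⟩
    classical
    refine Set.infinite_of_injective_forall_mem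
      (f := fun b => Nat.pair x (Nat.pair b (Nat.find (hex b)))) (fun a b hab => ?_) fun b => ?_
    · exact (Nat.pair_eq_pair.1 (Nat.pair_eq_pair.1 hab).2).1
    · refine ⟨?_, by simp⟩
      simp only [C, Set.mem_ofPred_eq, Nat.unpair_pair]
      exact ⟨Nat.find_spec (hex b), fun t ht => Nat.find_min (hex b) ht⟩

theorem DeltaTwoBiembCategorical.finitelyManyInfinite {A : EquivStructure}
    (h : A.DeltaTwoBiembCategorical) : A.FinitelyManyInfinite := by
  by_contra hA
  obtain ⟨S, hS, hSinf, hsimple⟩ := exists_sig_two_simple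
  obtain ⟨C, hC, hCS⟩ := exists_computable_infinite_iff hS
  have hU : ComputablePred fun n => n ∈ (Set.univ : Set ℕ) :=
    (ComputablePred.mem_finite Set.finite_empty).not.of_eq fun n => by simp
  have hUinf : ∀ x : ℕ, {k ∈ (Set.univ : Set ℕ) | k.unpair.1 = x}.Infinite := fun x =>
    Set.infinite_of_injective_forall_mem (f := fun b => Nat.pair x b)
      (fun a b hab => (Nat.pair_eq_pair.1 hab).2) fun b => by simp
  obtain ⟨-, g, hg⟩ := h (ofFst Set.univ hU) ofFst_isComputable
    ⟨exists_embedding_ofFst A (Set.infinite_univ.mono fun x _ => hUinf x),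
      exists_embedding_of_not_finitelyManyInfinite hA _⟩
  obtain ⟨⟨f, hf⟩, -⟩ := h (ofFst C hC) ofFst_isComputable
    ⟨exists_embedding_ofFst A (hSinf.mono fun x hx => (hCS x).2 hx),
      exists_embedding_of_not_finitelyManyInfinite hA _⟩
  have hcomp := (Nat.RecursiveIn.comp (RecursiveIn.iff_nat.1 hf)
    (RecursiveIn.iff_nat.1 hg)).sig_graph (X := ∅)
  let F : Embedding (ofFst Set.univ hU) (ofFst C hC) := g.trans f
  let φ : ℕ → ℕ := fun p => F ⟨p, trivial⟩
  have hφC : ∀ p, φ p ∈ C := fun p => (F ⟨p, trivial⟩).2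
  have hφ : ∀ p q, (φ p).unpair.1 = (φ q).unpair.1 ↔ p.unpair.1 = q.unpair.1 := fun p q =>
    F.map_rel_iff (a := ⟨p, trivial⟩) (b := ⟨q, trivial⟩)
  have hφinj : Function.Injective φ := fun p q hpq =>
    congrArg Subtype.val (F.injective (Subtype.ext hpq))
  have hmem : ∀ p y, (y ∈ (g.toPFun p >>= f.toPFun)) ↔ φ p = y := by
    intro p y
    refine Part.mem_bind_iff.trans ⟨?_, ?_⟩
    · rintro ⟨z, ⟨hz, rfl⟩, ⟨hy, rfl⟩⟩
      rfl
    · rintro rfl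
      exact ⟨_, ⟨trivial, rfl⟩, ⟨(g ⟨p, trivial⟩).2, rfl⟩⟩
  -- These are the classes of `ofFst C hC` that meet the range of the composite embedding.
  have hW : Sig ∅ 2 fun x => ∃ p y, φ p = y ∧ y.unpair.1 = x :=
    .ex (.ex (.and ((hcomp.of_iff fun q : ℕ × ℕ => (hmem q.1 q.2).symm).comp
      (f := fun q : (ℕ × ℕ) × ℕ => (q.1.2, q.2)) (by fun_prop))
      (.eq_nat (by fun_prop) (by fun_prop))))
  obtain ⟨x, ⟨p, _, rfl, hx⟩, hSx⟩ := hsimple _ hW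
    (Set.infinite_of_injective_forall_mem (f := fun i => (φ (Nat.pair i 0)).unpair.1)
      (fun i j hij => by simpa using (hφ _ _).1 hij) fun i => ⟨_, _, rfl, rfl⟩)
  -- The class of `x` contains the injective image of an infinite class, so `x` is not in `S`.
  refine (hCS x).1 (Set.infinite_of_injective_forall_mem
    (f := fun j => φ (Nat.pair p.unpair.1 j)) (fun i j hij => ?_) fun j => ?_) hSx
  · exact (Nat.pair_eq_pair.1 (hφinj hij)).2
  · exact ⟨hφC _, by rw [← hx, hφ]; simp⟩

end EquivStructure

theorem mainTheorem6 (A : EquivStructure) (hA : A.IsComputable) :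
    A.DeltaTwoBiembCategorical ↔ A.RelativelyDeltaBiembCategorical 2 :=
  ⟨fun h => h.finitelyManyInfinite.relativelyDelta, fun h => h.deltaTwo hA⟩
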